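/- Let $d\in\mathbb N$, $T>0$, $\gamma\in(\tfrac13,1]$, $\alpha>0$ and $R>0$. *Hölder spaces.* For a normed space $F$, $\mathcal C^\alpha_b(\mathbb R^d,F)$ is the space of $\mathcal C^{\lfloor\alpha\rfloor}$ functions $f:\mathbb R^d\to F$ with finite norm $$|f|_{\mathcal C^\alpha_b}=\sup_{|\ell|\le\lfloor\alpha\rfloor}\sup_x|D^\ell f(x)|+\sup_{|\ell|=\lfloor\alpha\rfloor}\sup_{x\ne y}\frac{|D^\ell f(x)-D^\ell f(y)|}{|x-y|^{\alpha-\lfloor\alpha\rfloor}}.$$ Let $\mathcal C^\alpha_R$ be the subspace of those $f\in\mathcal C^\alpha_b(\mathbb R^d,\mathbb R^d)$ whose support is contained in the closed ball $\overline B_R=\{|x|\le R\}$. The tensor product $\mathcal C^\alpha_R\otimes\mathcal C^\alpha_R$ is the completion of the algebraic tensor product for the norm of $\mathcal C_b^\alpha\big(\mathbb R^d,\mathcal C_b^\alpha(\mathbb R^d,\mathbb R^d\otimes\mathbb R^d)\big)$, that is, the closed linear span in that space of the functions $(f\otimes g)(x,y)=f(x)\otimes g(y)$ with $f,g\in\mathcal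 C^\alpha_R$. *Rough paths.* Let $\Delta_T=\{(s,t):0\le s\le t\le T\}$ and $X_{s,t}=X_t-X_s$. The set $\mathscr C^\gamma([0,T],\mathcal C^\alpha_R)$ consists of the pairs $\mathbf X=(X,\mathbb X)$ with $X:[0,T]\to\mathcal C^\alpha_R$, $X_0=0$, and $\mathbb X:\Delta_T\to\mathcal C^\alpha_R\otimes\mathcal C^\alpha_R$ such that $\mathbb X_{s,t}-\mathbb X_{s,u}-\mathbb X_{u,t}=X_{s,u}\otimes X_{u,t}$ for $0\le s\le u\le t\le T$ and $$|\mathbf X|_{\mathcal C^\gamma\oplus\mathcal C^{2\gamma}}=\sup_{s<t}\frac{|X_{s,t}|}{|t-s|^\gamma}+\sup_{s<t}\frac{|\mathbb X_{s,t}|}{|t-s|^{2\gamma}}<\infty ;$$ it is a metric space with the distance $\sup_{s<t}\frac{|X_{s,t}-Y_{s,t}|}{|t-s|^\gamma}+\sup_{s<t}\frac{|\mathbb X_{s,t}-\mathbb Y_{s,t}|}{|t-s|^{2\gamma}}$. Let $$\mathscr C^{\gamma-}([0,T],\mathcal C^{\alpha-}_R)=\bigcap_{0<\gamma'<\gamma,\;0<\alpha'<\alpha}\mathscr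 C^{\gamma'}([0,T],\mathcal C^{\alpha'}_R)$$ with the coarsest topology that makes all the inclusions into the spaces $\mathscr C^{\gamma'}([0,T],\mathcal C^{\alpha'}_R)$ continuous. All these spaces carry their Borel $\sigma$-algebras. Two random variables $\mathbf X,\mathbf Y$ with values in $\mathscr C^{\gamma-}([0,T],\mathcal C^{\alpha-}_R)$ have the same finite-dimensional space-time distributions if for all $m\in\mathbb N$, $0\le t_1<\dots<t_m\le T$ and $x^i_1,\dots,x^i_m\in\mathbb R^d$ ($i=1,2$) the vectors $\big(X_{t_j}(x^1_j),\mathbb X_{0,t_j}(x^1_j,x^2_j)\big)_{j\le m}$ and $\big(Y_{t_j}(x^1_j),\mathbb Y_{0,t_j}(x^1_j,x^2_j)\big)_{j\le m}$ have the same law. A weak limit point of a sequence of random variables is a weak limit of one of its subsequences. **Proposition.** Let $(\mathbf X^n)_{n\in\mathbb N}$ be a sequence of random variables with values in $\mathscr C^\gamma([0,T],\mathcal C^\alpha_R)$, possibly defined on different probability spaces. Suppose that $$\sup_{n\in\mathbb N}\mathbb E\big[|\mathbf X^n|^p_{\mathcal C^\gamma\oplus\mathcal C^{2\gamma}}\big]<\infty\quad\text{for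 some real } p\ge1,$$ and that any two weak limit points of $(\mathbf X^n)_{n\in\mathbb N}$ in $\mathscr C^{\gamma-}([0,T],\mathcal C^{\alpha-}_R)$ have the same finite-dimensional space-time distributions. Then there is a random variable $\mathbf X$ with values in $\mathscr C^{\gamma-}([0,T],\mathcal C^{\alpha-}_R)$ such that $\mathbf X^n\Rightarrow\mathbf X$ weakly in $\mathscr C^{\gamma-}([0,T],\mathcal C^{\alpha-}_R)$. -/

import Mathlib

open Set Filter Topology MeasureTheory
open scoped ENNReal

noncomputable section

namespace RoughHolder

/-- Euclidean space `ℝ^d`. -/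
abbrev Vec (d : ℕ) : Type := EuclideanSpace ℝ (Fin d)

/-- The tensor product `ℝ^d ⊗ ℝ^d`, identified with `d × d` arrays and their Euclidean norm. -/
abbrev Mat (d : ℕ) : Type := EuclideanSpace ℝ (Fin d × Fin d)

/-! ### Hölder spaces -/

section Holder

variable {d : ℕ} {F : Type*} [NormedAddCommGroup F] [NormedSpace ℝ F]
variable {G : Type*} [NormedAddCommGroup G] [NormedSpace ℝ G]

/-- The iterated partial derivative `∂_{j 0} ⋯ ∂_{j (k-1)} f (x)`.  As `j` ranges over all maps
`Fin k → Fin d`, these are the derivatives `D^ℓ f (x)` with multi-indices `|ℓ| = k`. -/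
def partialD {k : ℕ} (j : Fin k → Fin d) (f : Vec d → F) (x : Vec d) : F :=
  iteratedFDeriv ℝ k f x (fun i => EuclideanSpace.single (j i) 1)

/-- `sup_{|ℓ| ≤ ⌊α⌋} sup_x |D^ℓ f(x)|`. -/
def supPart (α : ℝ) (f : Vec d → F) : ℝ≥0∞ :=
  ⨆ (k : ℕ) (_ : k ≤ ⌊α⌋₊) (j : Fin k → Fin d) (x : Vec d), ‖partialD j f x‖ₑ

/-- `sup_{|ℓ| = ⌊α⌋} sup_{x ≠ y} |D^ℓ f(x) - D^ℓ f(y)| / |x - y|^{α - ⌊α⌋}`. -/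
def holderPart (α : ℝ) (f : Vec d → F) : ℝ≥0∞ :=
  ⨆ (j : Fin ⌊α⌋₊ → Fin d) (x : Vec d) (y : Vec d) (_ : x ≠ y),
    ‖partialD j f x - partialD j f y‖ₑ / ENNReal.ofReal (dist x y ^ (α - ⌊α⌋₊))

/-- The norm of `C_b^α(ℝ^d, F)`, with values in `[0, ∞]`. -/
def holderENorm (α : ℝ) (f : Vec d → F) : ℝ≥0∞ := supPart α f + holderPart α f

theorem enorm_partialD_le_supPart {α : ℝ} {k : ℕ} (hk : k ≤ ⌊α⌋₊) (j : Fin k → Fin d)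
    (f : Vec d → F) (x : Vec d) : ‖partialD j f x‖ₑ ≤ supPart α f :=
  le_iSup_of_le k (le_iSup_of_le hk (le_iSup_of_le j
    (le_iSup (fun x => ‖partialD j f x‖ₑ) x)))

theorem enorm_partialD_le {α : ℝ} {k : ℕ} (hk : k ≤ ⌊α⌋₊) (j : Fin k → Fin d)
    (f : Vec d → F) (x : Vec d) : ‖partialD j f x‖ₑ ≤ holderENorm α f :=
  (enorm_partialD_le_supPart hk j f x).trans le_self_add

theorem enorm_apply_le {α : ℝ} (f : Vec d → F) (x : Vec d) : ‖f x‖ₑ ≤ holderENorm α f := by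
  have h := enorm_partialD_le (α := α) (Nat.zero_le _) (Fin.elim0 : Fin 0 → Fin d) f x
  simpa [partialD] using h

theorem div_le_holderPart {α : ℝ} (j : Fin ⌊α⌋₊ → Fin d) (f : Vec d → F) {x y : Vec d}
    (hxy : x ≠ y) :
    ‖partialD j f x - partialD j f y‖ₑ / ENNReal.ofReal (dist x y ^ (α - ⌊α⌋₊))
      ≤ holderPart α f :=
  le_iSup_of_le j (le_iSup_of_le x (le_iSup_of_le y
    (le_iSup (fun _ : x ≠ y => ‖partialD j f x - partialD j f y‖ₑ /
      ENNReal.ofReal (dist x y ^ (α - ⌊α⌋₊))) hxy)))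

theorem holderENorm_add_le {α : ℝ} {f g : Vec d → F} (hf : ContDiff ℝ ⌊α⌋₊ f)
    (hg : ContDiff ℝ ⌊α⌋₊ g) :
    holderENorm α (f + g) ≤ holderENorm α f + holderENorm α g := by
  have key : ∀ {k : ℕ}, k ≤ ⌊α⌋₊ → ∀ (j : Fin k → Fin d) (x : Vec d),
      partialD j (f + g) x = partialD j f x + partialD j g x := by
    intro k hk j x
    simp only [partialD]
    rw [iteratedFDeriv_add_apply ((hf.of_le (by exact_mod_cast hk)).contDiffAt)
      ((hg.of_le (by exact_mod_cast hk)).contDiffAt)]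
    rfl
  have h1 : supPart α (f + g) ≤ supPart α f + supPart α g := by
    refine iSup_le fun k => iSup_le fun hk => iSup_le fun j => iSup_le fun x => ?_
    rw [key hk]
    exact (enorm_add_le _ _).trans (add_le_add (enorm_partialD_le_supPart hk j f x)
      (enorm_partialD_le_supPart hk j g x))
  have h2 : holderPart α (f + g) ≤ holderPart α f + holderPart α g := by
    refine iSup_le fun j => iSup_le fun x => iSup_le fun y => iSup_le fun hxy => ?_
    rw [key le_rfl, key le_rfl, add_sub_add_comm]
    refine le_trans ?_ (add_le_add (div_le_holderPart j f hxy) (div_le_holderPart j g hxy))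
    rw [← ENNReal.add_div]
    exact ENNReal.div_le_div_right (enorm_add_le _ _) _
  calc holderENorm α (f + g) ≤ (supPart α f + supPart α g) + (holderPart α f + holderPart α g) :=
        add_le_add h1 h2
    _ = _ := by simp only [holderENorm]; abel

/-- Composition with a bounded linear map. -/
theorem holderENorm_clm_comp_le {α : ℝ} {f : Vec d → F} (hf : ContDiff ℝ ⌊α⌋₊ f)
    (L : F →L[ℝ] G) :
    holderENorm α (fun x => L (f x)) ≤ ‖L‖ₑ * holderENorm α f := by
  have key : ∀ {k : ℕ}, k ≤ ⌊α⌋₊ → ∀ (j : Fin k → Fin d) (x : Vec d),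
      partialD j (fun x => L (f x)) x = L (partialD j f x) := by
    intro k hk j x
    have := L.iteratedFDeriv_comp_left (hf.contDiffAt (x := x)) (i := k)
      (by exact_mod_cast hk)
    simp only [partialD]
    change iteratedFDeriv ℝ k (L ∘ f) x _ = _
    rw [this]
    rfl
  have h1 : supPart α (fun x => L (f x)) ≤ ‖L‖ₑ * supPart α f := by
    refine iSup_le fun k => iSup_le fun hk => iSup_le fun j => iSup_le fun x => ?_
    rw [key hk]
    exact (L.le_opENorm _).trans (mul_le_mul_right (enorm_partialD_le_supPart hk j f x) _)
  have h2 : holderPart α (fun x => L (f x)) ≤ ‖L‖ₑ * holderPart α f := by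
    refine iSup_le fun j => iSup_le fun x => iSup_le fun y => iSup_le fun hxy => ?_
    rw [key le_rfl, key le_rfl, ← map_sub]
    refine le_trans ?_ (mul_le_mul_right (div_le_holderPart j f hxy) _)
    rw [← mul_div_assoc]
    exact ENNReal.div_le_div_right (L.le_opENorm _) _
  calc _ ≤ ‖L‖ₑ * supPart α f + ‖L‖ₑ * holderPart α f := add_le_add h1 h2
    _ = _ := by rw [← mul_add]; rfl

theorem holderENorm_zero {α : ℝ} : holderENorm α (0 : Vec d → F) = 0 := by
  have h := holderENorm_clm_comp_le (α := α) (f := (0 : Vec d → F))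
    (contDiff_zero_fun (𝕜 := ℝ)) (0 : F →L[ℝ] F)
  have e : (fun x => (0 : F →L[ℝ] F) ((0 : Vec d → F) x)) = (0 : Vec d → F) := by
    ext; simp
  rw [e, ← ofReal_norm, norm_zero, ENNReal.ofReal_zero, zero_mul] at h
  exact le_antisymm h bot_le

theorem holderENorm_smul_le {α : ℝ} {f : Vec d → F} (hf : ContDiff ℝ ⌊α⌋₊ f) (c : ℝ) :
    holderENorm α (c • f) ≤ ‖c‖ₑ * holderENorm α f := by
  have h := holderENorm_clm_comp_le hf (c • ContinuousLinearMap.id ℝ F)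
  have e : (fun x => (c • ContinuousLinearMap.id ℝ F) (f x)) = c • f := by
    ext; simp
  rw [e] at h
  refine h.trans (mul_le_mul_left ?_ _)
  rw [enorm_smul]
  calc ‖c‖ₑ * ‖ContinuousLinearMap.id ℝ F‖ₑ ≤ ‖c‖ₑ * 1 := by
        refine mul_le_mul_right ?_ _
        rw [← ofReal_norm]
        exact ENNReal.ofReal_le_one.2 ContinuousLinearMap.norm_id_le
    _ = ‖c‖ₑ := mul_one _

variable (d) (F) in
/-- The functions of class `C^{⌊α⌋}` with finite Hölder norm, as a linear subspace. -/
def holderSubmodule (α : ℝ) : Submodule ℝ (Vec d → F) where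
  carrier := {f | ContDiff ℝ ⌊α⌋₊ f ∧ holderENorm α f < ∞}
  add_mem' {f g} hf hg := ⟨hf.1.add hg.1,
    (holderENorm_add_le hf.1 hg.1).trans_lt (ENNReal.add_lt_top.2 ⟨hf.2, hg.2⟩)⟩
  zero_mem' := ⟨contDiff_zero_fun, by rw [holderENorm_zero]; exact ENNReal.zero_lt_top⟩
  smul_mem' c f hf := ⟨hf.1.const_smul c,
    (holderENorm_smul_le hf.1 c).trans_lt (ENNReal.mul_lt_top enorm_lt_top hf.2)⟩

variable (d) (F) in
/-- The Hölder space `C_b^α(ℝ^d, F)`. -/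
def HolderSpace (α : ℝ) : Type _ := holderSubmodule d F α

namespace HolderSpace

variable {α : ℝ}

instance : AddCommGroup (HolderSpace d F α) := inferInstanceAs (AddCommGroup (holderSubmodule d F α))

instance : Module ℝ (HolderSpace d F α) := inferInstanceAs (Module ℝ (holderSubmodule d F α))

instance : FunLike (HolderSpace d F α) (Vec d) F where
  coe f := f.1
  coe_injective _ _ h := Subtype.ext h

@[ext] theorem ext {f g : HolderSpace d F α} (h : ∀ x, f x = g x) : f = g := DFunLike.ext _ _ h

theorem contDiff (f : HolderSpace d F α) : ContDiff ℝ ⌊α⌋₊ (f : Vec d → F) := f.2.1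

theorem holderENorm_lt_top (f : HolderSpace d F α) : holderENorm α (f : Vec d → F) < ∞ := f.2.2

theorem coe_add (f g : HolderSpace d F α) : ((f + g : HolderSpace d F α) : Vec d → F) = f + g := rfl

theorem coe_smul (c : ℝ) (f : HolderSpace d F α) :
    ((c • f : HolderSpace d F α) : Vec d → F) = c • (f : Vec d → F) := rfl

@[simp] theorem add_apply (f g : HolderSpace d F α) (x : Vec d) : (f + g) x = f x + g x := rfl

@[simp] theorem zero_apply (x : Vec d) : (0 : HolderSpace d F α) x = 0 := rfl

@[simp] theorem sub_apply (f g : HolderSpace d F α) (x : Vec d) : (f - g) x = f x - g x := rfl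

@[simp] theorem smul_apply (c : ℝ) (f : HolderSpace d F α) (x : Vec d) : (c • f) x = c • f x := rfl

instance : Norm (HolderSpace d F α) where
  norm f := (holderENorm α (f : Vec d → F)).toReal

theorem norm_def (f : HolderSpace d F α) : ‖f‖ = (holderENorm α (f : Vec d → F)).toReal := rfl

theorem core : NormedSpace.Core ℝ (HolderSpace d F α) where
  norm_nonneg _ := ENNReal.toReal_nonneg
  norm_smul c f := by
    have le : ∀ (c : ℝ) (f : HolderSpace d F α), ‖c • f‖ ≤ ‖c‖ * ‖f‖ := by
      intro c f
      have h := ENNReal.toReal_mono (ENNReal.mul_lt_top enorm_lt_top f.holderENorm_lt_top).ne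
        (holderENorm_smul_le f.contDiff c)
      rw [ENNReal.toReal_mul, toReal_enorm] at h
      exact h
    refine le_antisymm (le c f) ?_
    rcases eq_or_ne c 0 with rfl | hc
    · rw [norm_zero, zero_mul]
      exact ENNReal.toReal_nonneg
    · have h := le c⁻¹ (c • f)
      rw [inv_smul_smul₀ hc, norm_inv] at h
      rwa [← div_eq_inv_mul, le_div_iff₀' (norm_pos_iff.2 hc)] at h
  norm_triangle f g := by
    have h := ENNReal.toReal_mono
      (ENNReal.add_lt_top.2 ⟨f.holderENorm_lt_top, g.holderENorm_lt_top⟩).ne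
      (holderENorm_add_le f.contDiff g.contDiff)
    rwa [ENNReal.toReal_add f.holderENorm_lt_top.ne g.holderENorm_lt_top.ne] at h
  norm_eq_zero_iff f := by
    constructor
    · intro h
      have h0 : holderENorm α (f : Vec d → F) = 0 :=
        ((ENNReal.toReal_eq_zero_iff _).1 h).resolve_right f.holderENorm_lt_top.ne
      ext x
      have h1 := enorm_apply_le (α := α) (f : Vec d → F) x
      rw [h0] at h1
      exact enorm_eq_zero.1 (le_antisymm h1 bot_le)
    · rintro rfl
      change (holderENorm α (0 : Vec d → F)).toReal = 0
      rw [holderENorm_zero, ENNReal.toReal_zero]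

instance : NormedAddCommGroup (HolderSpace d F α) := NormedAddCommGroup.ofCore core

instance : NormedSpace ℝ (HolderSpace d F α) := NormedSpace.ofCore core

theorem enorm_eq (f : HolderSpace d F α) : ‖f‖ₑ = holderENorm α (f : Vec d → F) := by
  rw [← ofReal_norm, norm_def, ENNReal.ofReal_toReal f.holderENorm_lt_top.ne]

/-- Composition of a Hölder function with a bounded linear map. -/
def clmComp (L : F →L[ℝ] G) (f : HolderSpace d F α) : HolderSpace d G α :=
  ⟨fun x => L (f x), L.contDiff.comp f.contDiff,
    (holderENorm_clm_comp_le f.contDiff L).trans_lt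
      (ENNReal.mul_lt_top enorm_lt_top f.holderENorm_lt_top)⟩

@[simp] theorem clmComp_apply (L : F →L[ℝ] G) (f : HolderSpace d F α) (x : Vec d) :
    clmComp L f x = L (f x) := rfl

end HolderSpace

/-! The embedding `C_b^α ⊂ C_b^{α'}` for `0 < α' ≤ α`. -/

theorem norm_partialD_sub_le_dist {α N : ℝ} {f : Vec d → F} (hf : ContDiff ℝ ⌊α⌋₊ f)
    (hN : ∀ {k : ℕ}, k ≤ ⌊α⌋₊ → ∀ (j : Fin k → Fin d) (x : Vec d), ‖partialD j f x‖ ≤ N)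
    {k : ℕ} (hk : k < ⌊α⌋₊) (j : Fin k → Fin d) (x y : Vec d) :
    ‖partialD j f x - partialD j f y‖ ≤ d * N * dist x y := by
  have hd : Differentiable ℝ (iteratedFDeriv ℝ k f) :=
    hf.differentiable_iteratedFDeriv (by exact_mod_cast hk)
  set e : Fin k → Vec d := fun i => EuclideanSpace.single (j i) 1 with he
  have hder : ∀ z, HasFDerivAt (partialD j f)
      ((ContinuousMultilinearMap.apply ℝ (fun _ : Fin k => Vec d) F e).comp
        (fderiv ℝ (iteratedFDeriv ℝ k f) z)) z := fun z =>
    (ContinuousMultilinearMap.apply ℝ (fun _ : Fin k => Vec d) F e).hasFDerivAt.comp z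
      (hd z).hasFDerivAt
  have hbound : ∀ z, ‖(ContinuousMultilinearMap.apply ℝ (fun _ : Fin k => Vec d) F e).comp
        (fderiv ℝ (iteratedFDeriv ℝ k f) z)‖ ≤ d * N := by
    intro z
    have hN0 : 0 ≤ N := (norm_nonneg _).trans (hN hk.le j z)
    refine ContinuousLinearMap.opNorm_le_bound _ (by positivity) fun v => ?_
    set L := (ContinuousMultilinearMap.apply ℝ (fun _ : Fin k => Vec d) F e).comp
        (fderiv ℝ (iteratedFDeriv ℝ k f) z) with hL
    have hsum : v = ∑ i, v i • EuclideanSpace.single i (1 : ℝ) := by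
      ext m
      simp [Finset.sum_apply, Pi.single_apply]
    have hbas : ∀ i : Fin d, ‖L (EuclideanSpace.single i (1 : ℝ))‖ ≤ N := by
      intro i
      have h := hN (Nat.succ_le_of_lt hk) (Fin.cons i j : Fin (k + 1) → Fin d) z
      have e2 : partialD (Fin.cons i j : Fin (k + 1) → Fin d) f z
          = L (EuclideanSpace.single i (1 : ℝ)) := by
        simp only [partialD, iteratedFDeriv_succ_apply_left, hL]
        rfl
      rwa [e2] at h
    calc ‖L v‖ = ‖∑ i, v i • L (EuclideanSpace.single i (1 : ℝ))‖ := by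
          conv_lhs => rw [hsum]
          simp only [map_sum, map_smul]
      _ ≤ ∑ i, ‖v i • L (EuclideanSpace.single i (1 : ℝ))‖ := norm_sum_le _ _
      _ ≤ ∑ _i : Fin d, ‖v‖ * N := by
          refine Finset.sum_le_sum fun i _ => ?_
          rw [norm_smul]
          exact mul_le_mul (PiLp.norm_apply_le v i) (hbas i) (norm_nonneg _) (norm_nonneg _)
      _ = d * N * ‖v‖ := by
          simp only [Finset.sum_const, Finset.card_univ, Fintype.card_fin, nsmul_eq_mul]
          ring
  have h := convex_univ.norm_image_sub_le_of_norm_hasFDerivWithin_le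
    (fun z _ => (hder z).hasFDerivWithinAt) (fun z _ => hbound z) (mem_univ y) (mem_univ x)
  rwa [← dist_eq_norm x y] at h

theorem interp_bound {a N c r b β : ℝ} (hr : 0 < r) (hN : 0 ≤ N) (hc : 0 ≤ c) (hβ : 0 ≤ β)
    (hβb : β ≤ b) (h1 : a ≤ 2 * N) (h2 : a ≤ c * N * r ^ b) : a ≤ (2 + c) * N * r ^ β := by
  have hp : 0 < r ^ β := Real.rpow_pos_of_pos hr β
  rcases le_total r 1 with hr1 | hr1
  · have h3 : r ^ b ≤ r ^ β := Real.rpow_le_rpow_of_exponent_ge hr hr1 hβb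
    have h4 : c * N * r ^ b ≤ c * N * r ^ β := mul_le_mul_of_nonneg_left h3 (by positivity)
    nlinarith [mul_nonneg hN hp.le]
  · have h3 : 1 ≤ r ^ β := Real.one_le_rpow hr1 hβ
    have h4 : 2 * N * 1 ≤ 2 * N * r ^ β := mul_le_mul_of_nonneg_left h3 (by positivity)
    have h5 : 0 ≤ c * N * r ^ β := by positivity
    nlinarith

theorem holderENorm_mono {α α' : ℝ} (h0 : 0 < α') (hα : α' ≤ α) {f : Vec d → F}
    (hf : ContDiff ℝ ⌊α⌋₊ f) (hfin : holderENorm α f < ∞) :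
    holderENorm α' f ≤ ENNReal.ofReal (d + 4) * holderENorm α f := by
  set N : ℝ := (holderENorm α f).toReal with hNdef
  have hN0 : 0 ≤ N := ENNReal.toReal_nonneg
  have hNe : ENNReal.ofReal N = holderENorm α f := ENNReal.ofReal_toReal hfin.ne
  have hN : ∀ {k : ℕ}, k ≤ ⌊α⌋₊ → ∀ (j : Fin k → Fin d) (x : Vec d), ‖partialD j f x‖ ≤ N := by
    intro k hk j x
    have h := ENNReal.toReal_mono hfin.ne (enorm_partialD_le hk j f x)
    rwa [toReal_enorm] at h
  have hfl : ⌊α'⌋₊ ≤ ⌊α⌋₊ := Nat.floor_mono hα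
  have hβ : 0 ≤ α' - ⌊α'⌋₊ := sub_nonneg.2 (Nat.floor_le h0.le)
  have hβ1 : α' - ⌊α'⌋₊ ≤ 1 := by linarith [Nat.lt_floor_add_one α']
  have h1 : supPart α' f ≤ holderENorm α f :=
    iSup_le fun k => iSup_le fun hk => iSup_le fun j => iSup_le fun x =>
      enorm_partialD_le (hk.trans hfl) j f x
  have h2 : holderPart α' f ≤ ENNReal.ofReal (d + 3) * holderENorm α f := by
    refine iSup_le fun j => iSup_le fun x => iSup_le fun y => iSup_le fun hxy => ?_
    have hr : 0 < dist x y := dist_pos.2 hxy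
    have h2N : ‖partialD j f x - partialD j f y‖ ≤ 2 * N := by
      linarith [norm_sub_le (partialD j f x) (partialD j f y), hN hfl j x, hN hfl j y]
    have main : ‖partialD j f x - partialD j f y‖
        ≤ (d + 3) * N * dist x y ^ (α' - ⌊α'⌋₊) := by
      have hp : 0 ≤ N * dist x y ^ (α' - ⌊α'⌋₊) := by positivity
      rcases hfl.lt_or_eq with hlt | heq
      · have h3 := norm_partialD_sub_le_dist hf hN hlt j x y
        have h4 := interp_bound hr hN0 (Nat.cast_nonneg d) hβ hβ1 h2N
          (by simpa only [Real.rpow_one] using h3)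
        nlinarith
      · have hq := (div_le_holderPart (heq ▸ j : Fin ⌊α⌋₊ → Fin d) f hxy).trans
          (le_add_self : holderPart α f ≤ holderENorm α f)
        have e3 : ∀ z, partialD (heq ▸ j : Fin ⌊α⌋₊ → Fin d) f z = partialD j f z := by
          intro z
          generalize ⌊α⌋₊ = m at heq
          subst heq
          rfl
        rw [e3, e3] at hq
        have hrp : 0 < dist x y ^ (α - ⌊α⌋₊) := Real.rpow_pos_of_pos hr _
        rw [ENNReal.div_le_iff (by simpa using hrp) ENNReal.ofReal_ne_top] at hq
        change _ ≤ holderENorm α f * _ at hq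
        rw [← hNe, ← ENNReal.ofReal_mul hN0, ← ofReal_norm,
          ENNReal.ofReal_le_ofReal_iff (by positivity)] at hq
        have h4 := interp_bound (b := α - ⌊α⌋₊) hr hN0 zero_le_one hβ
          (by rw [heq]; linarith) h2N (by simpa only [one_mul] using hq)
        have hdd : (0 : ℝ) ≤ d := Nat.cast_nonneg d
        nlinarith
    have hrp : 0 < dist x y ^ (α' - ⌊α'⌋₊) := Real.rpow_pos_of_pos hr _
    rw [ENNReal.div_le_iff (by simpa using hrp) ENNReal.ofReal_ne_top, ← hNe,
      ← ENNReal.ofReal_mul (by positivity), ← ENNReal.ofReal_mul (by positivity), ← ofReal_norm]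
    exact ENNReal.ofReal_le_ofReal main
  calc holderENorm α' f ≤ holderENorm α f + ENNReal.ofReal (d + 3) * holderENorm α f :=
        add_le_add h1 h2
    _ = ENNReal.ofReal (d + 4) * holderENorm α f := by
        rw [← one_add_mul, ← ENNReal.ofReal_one, ← ENNReal.ofReal_add zero_le_one (by positivity)]
        congr 2
        ring

namespace HolderSpace

/-- The continuous embedding `C_b^α(ℝ^d, F) → C_b^{α'}(ℝ^d, F)` for `0 < α' ≤ α`. -/
def incl {α α' : ℝ} (h0 : 0 < α') (hα : α' ≤ α) : HolderSpace d F α →L[ℝ] HolderSpace d F α' :=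
  LinearMap.mkContinuous
    { toFun := fun f => ⟨f, f.contDiff.of_le (by exact_mod_cast Nat.floor_mono hα),
        (holderENorm_mono h0 hα f.contDiff f.holderENorm_lt_top).trans_lt
          (ENNReal.mul_lt_top ENNReal.ofReal_lt_top f.holderENorm_lt_top)⟩
      map_add' := fun _ _ => rfl
      map_smul' := fun _ _ => rfl }
    (d + 4) fun f => by
      have h := ENNReal.toReal_mono (ENNReal.mul_lt_top ENNReal.ofReal_lt_top
        f.holderENorm_lt_top).ne (holderENorm_mono h0 hα f.contDiff f.holderENorm_lt_top)
      rw [ENNReal.toReal_mul, ENNReal.toReal_ofReal (by positivity)] at h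
      exact h

@[simp] theorem incl_apply {α α' : ℝ} (h0 : 0 < α') (hα : α' ≤ α) (f : HolderSpace d F α)
    (x : Vec d) : incl h0 hα f x = f x := rfl

theorem clmComp_add {α : ℝ} (L : F →L[ℝ] G) (f g : HolderSpace d F α) :
    clmComp L (f + g) = clmComp L f + clmComp L g := by ext; simp

theorem clmComp_smul {α : ℝ} (L : F →L[ℝ] G) (c : ℝ) (f : HolderSpace d F α) :
    clmComp L (c • f) = c • clmComp L f := by ext; simp

variable (d) in
/-- `clmComp` as a continuous linear map. -/
def clmCompL (α : ℝ) (L : F →L[ℝ] G) : HolderSpace d F α →L[ℝ] HolderSpace d G α :=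
  LinearMap.mkContinuous
    { toFun := clmComp L, map_add' := clmComp_add L, map_smul' := clmComp_smul L } ‖L‖ fun f => by
      have h := ENNReal.toReal_mono (ENNReal.mul_lt_top enorm_lt_top
        f.holderENorm_lt_top).ne (holderENorm_clm_comp_le f.contDiff L)
      rw [ENNReal.toReal_mul, toReal_enorm] at h
      exact h

@[simp] theorem clmCompL_apply {α : ℝ} (L : F →L[ℝ] G) (f : HolderSpace d F α) (x : Vec d) :
    clmCompL d α L f x = L (f x) := rfl

end HolderSpace

end Holder

/-! ### The tensor product of Hölder spaces -/

section Tensor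

variable {d : ℕ}

/-- The tensor product of vectors, `(v ⊗ w)_{ij} = v_i w_j`, as a bilinear map. -/
def outer (d : ℕ) : Vec d →ₗ[ℝ] Vec d →ₗ[ℝ] Mat d :=
  LinearMap.mk₂ ℝ (fun v w => WithLp.toLp 2 fun p => v p.1 * w p.2)
    (by intros; ext; simp [add_mul]) (by intros; ext; simp [mul_assoc])
    (by intros; ext; simp [mul_add]) (by intros; ext; simp [mul_left_comm])

/-- The space `C_b^α(ℝ^d, C_b^α(ℝ^d, ℝ^d ⊗ ℝ^d))`. -/
abbrev BiHolder (d : ℕ) (α : ℝ) : Type := HolderSpace d (HolderSpace d (Mat d) α) α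

/-- The elementary tensor `f ⊗ g`, i.e. the function `x ↦ (y ↦ f(x) ⊗ g(y))`. -/
def tmul {α : ℝ} (f g : HolderSpace d (Vec d) α) : BiHolder d α :=
  HolderSpace.clmComp
    (LinearMap.toContinuousLinearMap
      { toFun := fun v => HolderSpace.clmComp (LinearMap.toContinuousLinearMap (outer d v)) g
        map_add' := fun v w => by ext; simp
        map_smul' := fun c v => by ext; simp }) f

@[simp] theorem tmul_apply {α : ℝ} (f g : HolderSpace d (Vec d) α) (x y : Vec d) (i j : Fin d) :
    tmul f g x y (i, j) = f x i * g y j := rfl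

/-- The space `C_R^α(ℝ^d, ℝ^d)` of Hölder functions supported in the closed ball of radius `R`. -/
def suppHolder (d : ℕ) (α R : ℝ) : Submodule ℝ (HolderSpace d (Vec d) α) where
  carrier := {f | tsupport (f : Vec d → Vec d) ⊆ Metric.closedBall 0 R}
  add_mem' {f g} hf hg := (tsupport_add (f : Vec d → Vec d) g).trans (union_subset hf hg)
  zero_mem' := by
    change tsupport (0 : Vec d → Vec d) ⊆ _
    simp
  smul_mem' c f hf := (tsupport_smul_subset_right (fun _ => c) (f : Vec d → Vec d)).trans hf

/-- The tensor product `C_R^α ⊗ C_R^α`: the completion of the algebraic tensor product for the norm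
of `C_b^α(ℝ^d, C_b^α(ℝ^d, ℝ^d ⊗ ℝ^d))`, that is, the closed linear span of the elementary tensors
in that space. -/
def suppTensor (d : ℕ) (α R : ℝ) : Submodule ℝ (BiHolder d α) :=
  (Submodule.span ℝ {u | ∃ f ∈ suppHolder d α R, ∃ g ∈ suppHolder d α R,
    u = tmul f g}).topologicalClosure

variable {α α' R : ℝ}

/-- The embedding `C_b^α(C_b^α) → C_b^{α'}(C_b^{α'})` for `0 < α' ≤ α`. -/
def biIncl (h0 : 0 < α') (hα : α' ≤ α) : BiHolder d α →L[ℝ] BiHolder d α' :=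
  (HolderSpace.incl h0 hα).comp (HolderSpace.clmCompL d α (HolderSpace.incl h0 hα))

@[simp] theorem biIncl_apply (h0 : 0 < α') (hα : α' ≤ α) (u : BiHolder d α) (x y : Vec d) :
    biIncl h0 hα u x y = u x y := rfl

theorem incl_mem_suppHolder (h0 : 0 < α') (hα : α' ≤ α) {f : HolderSpace d (Vec d) α}
    (hf : f ∈ suppHolder d α R) : HolderSpace.incl h0 hα f ∈ suppHolder d α' R := hf

theorem biIncl_tmul (h0 : 0 < α') (hα : α' ≤ α) (f g : HolderSpace d (Vec d) α) :
    biIncl h0 hα (tmul f g) = tmul (HolderSpace.incl h0 hα f) (HolderSpace.incl h0 hα g) := rfl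

theorem biIncl_mem_suppTensor (h0 : 0 < α') (hα : α' ≤ α) {u : BiHolder d α}
    (hu : u ∈ suppTensor d α R) : biIncl h0 hα u ∈ suppTensor d α' R := by
  refine map_mem_closure (biIncl h0 hα).continuous hu fun v hv => ?_
  change v ∈ Submodule.span ℝ _ at hv
  induction hv using Submodule.span_induction with
  | mem v hv =>
    obtain ⟨f, hf, g, hg, rfl⟩ := hv
    exact Submodule.subset_span ⟨_, incl_mem_suppHolder h0 hα hf, _,
      incl_mem_suppHolder h0 hα hg, biIncl_tmul h0 hα f g⟩
  | zero => rw [map_zero]; exact Submodule.zero_mem _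
  | add v w _ _ hv hw => rw [map_add]; exact Submodule.add_mem _ hv hw
  | smul c v _ hv => rw [map_smul]; exact Submodule.smul_mem _ c hv

/-- The embedding `C_R^α → C_R^{α'}` for `0 < α' ≤ α`. -/
def suppIncl (h0 : 0 < α') (hα : α' ≤ α) : suppHolder d α R →L[ℝ] suppHolder d α' R :=
  ((HolderSpace.incl h0 hα).comp (suppHolder d α R).subtypeL).codRestrict (suppHolder d α' R)
    fun f => incl_mem_suppHolder h0 hα f.2

/-- The embedding `C_R^α ⊗ C_R^α → C_R^{α'} ⊗ C_R^{α'}` for `0 < α' ≤ α`. -/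
def tensorIncl (h0 : 0 < α') (hα : α' ≤ α) : suppTensor d α R →L[ℝ] suppTensor d α' R :=
  ((biIncl h0 hα).comp (suppTensor d α R).subtypeL).codRestrict (suppTensor d α' R)
    fun u => biIncl_mem_suppTensor h0 hα u.2

end Tensor

/-! ### Rough paths -/

/-- The simplex `Δ_T = {(s, t) : 0 ≤ s ≤ t ≤ T}`. -/
abbrev Simplex (T : ℝ) : Type := {p : Icc (0 : ℝ) T × Icc (0 : ℝ) T // p.1 ≤ p.2}

/-- `sup_{s < t} |Z_{s,t}| / |t - s|^γ` for a two-parameter function `Z` on `Δ_T`. -/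
def timeENorm {T : ℝ} {V : Type*} [NormedAddCommGroup V] (γ : ℝ) (Z : Simplex T → V) : ℝ≥0∞ :=
  ⨆ (p : Simplex T) (_ : p.1.1 < p.1.2),
    ‖Z p‖ₑ / ENNReal.ofReal (((p.1.2 : ℝ) - p.1.1) ^ γ)

/-- The increments `X_{s,t} = X_t - X_s`. -/
def incr {T : ℝ} {V : Type*} [AddGroup V] (X : Icc (0 : ℝ) T → V) (p : Simplex T) : V :=
  X p.1.2 - X p.1.1

/-- A `γ`-rough path `(X, 𝕏)` on `[0, T]` with values in `C_R^α(ℝ^d, ℝ^d)` and `X_0 = 0`. -/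
structure RoughPath (T γ α R : ℝ) (d : ℕ) where
  /-- The path `X : [0, T] → C_R^α`. -/
  X : Icc (0 : ℝ) T → suppHolder d α R
  /-- The second order process `𝕏 : Δ_T → C_R^α ⊗ C_R^α`. -/
  XX : Simplex T → suppTensor d α R
  zero : ∀ t : Icc (0 : ℝ) T, (t : ℝ) = 0 → X t = 0
  holder_fst : timeENorm γ (incr X) < ∞
  holder_snd : timeENorm (2 * γ) XX < ∞
  chen : ∀ (s u t : Icc (0 : ℝ) T) (hsu : s ≤ u) (hut : u ≤ t),
    (XX ⟨(s, t), hsu.trans hut⟩ - XX ⟨(s, u), hsu⟩ - XX ⟨(u, t), hut⟩ : BiHolder d α)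
      = tmul ((X u - X s : suppHolder d α R) : HolderSpace d (Vec d) α)
          ((X t - X u : suppHolder d α R) : HolderSpace d (Vec d) α)

section TimeNorm

variable {T : ℝ} {V W : Type*} [NormedAddCommGroup V] [NormedAddCommGroup W] {γ γ' : ℝ}

theorem le_timeENorm (Z : Simplex T → V) {p : Simplex T} (hp : p.1.1 < p.1.2) :
    ‖Z p‖ₑ / ENNReal.ofReal (((p.1.2 : ℝ) - p.1.1) ^ γ) ≤ timeENorm γ Z :=
  le_iSup_of_le p (le_iSup (fun _ : p.1.1 < p.1.2 =>
    ‖Z p‖ₑ / ENNReal.ofReal (((p.1.2 : ℝ) - p.1.1) ^ γ)) hp)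

theorem timeENorm_add_le (Z Z' : Simplex T → V) :
    timeENorm γ (Z + Z') ≤ timeENorm γ Z + timeENorm γ Z' := by
  refine iSup_le fun p => iSup_le fun hp => ?_
  refine le_trans ?_ (add_le_add (le_timeENorm Z hp) (le_timeENorm Z' hp))
  rw [← ENNReal.add_div]
  exact ENNReal.div_le_div_right (enorm_add_le _ _) _

theorem timeENorm_neg (Z : Simplex T → V) : timeENorm γ (-Z) = timeENorm γ Z := by
  simp [timeENorm]

theorem timeENorm_sub_le (Z Z' : Simplex T → V) :
    timeENorm γ (Z - Z') ≤ timeENorm γ Z + timeENorm γ Z' := by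
  rw [sub_eq_add_neg, ← timeENorm_neg Z']
  exact timeENorm_add_le _ _

theorem timeENorm_zero : timeENorm γ (0 : Simplex T → V) = 0 := by
  simp [timeENorm]

theorem eq_zero_of_timeENorm {Z : Simplex T → V} (h : timeENorm γ Z = 0) {p : Simplex T}
    (hp : p.1.1 < p.1.2) : Z p = 0 := by
  have h1 := le_timeENorm (γ := γ) Z hp
  rw [h, nonpos_iff_eq_zero, ENNReal.div_eq_zero_iff] at h1
  exact enorm_eq_zero.1 (h1.resolve_right ENNReal.ofReal_ne_top)

theorem timeENorm_le_mul (hγ : γ' ≤ γ) {Z : Simplex T → V} {Z' : Simplex T → W} {C : ℝ≥0∞}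
    (hZ : ∀ p, ‖Z' p‖ₑ ≤ C * ‖Z p‖ₑ) :
    timeENorm γ' Z' ≤ C * ENNReal.ofReal (T ^ (γ - γ')) * timeENorm γ Z := by
  refine iSup_le fun p => iSup_le fun hp => ?_
  set r : ℝ := (p.1.2 : ℝ) - p.1.1 with hr
  have hr0 : 0 < r := sub_pos.2 hp
  have hrT : r ≤ T := by
    have h1 := p.1.2.2.2
    have h2 := p.1.1.2.1
    linarith
  have hg : 0 < r ^ γ := Real.rpow_pos_of_pos hr0 _
  have hg' : 0 < r ^ γ' := Real.rpow_pos_of_pos hr0 _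
  have h1 : ‖Z p‖ₑ ≤ timeENorm γ Z * ENNReal.ofReal (r ^ γ) := by
    have h := le_timeENorm (γ := γ) Z hp
    rwa [ENNReal.div_le_iff (by simpa using hg) ENNReal.ofReal_ne_top] at h
  rw [ENNReal.div_le_iff (by simpa using hg') ENNReal.ofReal_ne_top]
  have h2 : ENNReal.ofReal (r ^ γ) ≤ ENNReal.ofReal (T ^ (γ - γ')) * ENNReal.ofReal (r ^ γ') := by
    rw [← ENNReal.ofReal_mul (Real.rpow_nonneg (hr0.le.trans hrT) _)]
    refine ENNReal.ofReal_le_ofReal ?_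
    calc r ^ γ = r ^ (γ - γ') * r ^ γ' := by rw [← Real.rpow_add hr0]; ring_nf
      _ ≤ T ^ (γ - γ') * r ^ γ' := mul_le_mul_of_nonneg_right
          (Real.rpow_le_rpow hr0.le hrT (sub_nonneg.2 hγ)) hg'.le
  calc ‖Z' p‖ₑ ≤ C * ‖Z p‖ₑ := hZ p
    _ ≤ C * (timeENorm γ Z * (ENNReal.ofReal (T ^ (γ - γ')) * ENNReal.ofReal (r ^ γ'))) := by
        gcongr
        exact h1.trans (by gcongr)
    _ = _ := by ring

end TimeNorm

namespace RoughPath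

variable {T γ α R : ℝ} {d : ℕ}

/-- `|𝓧| = |X|_{C^γ} + |𝕏|_{C^{2γ}}`. -/
def enorm (𝓧 : RoughPath T γ α R d) : ℝ≥0∞ :=
  timeENorm γ (incr 𝓧.X) + timeENorm (2 * γ) 𝓧.XX

theorem XX_diag (𝓧 : RoughPath T γ α R d) {p : Simplex T} (hp : p.1.1 = p.1.2) : 𝓧.XX p = 0 := by
  obtain ⟨⟨s, t⟩, h⟩ := p
  obtain rfl : s = t := hp
  have h1 := 𝓧.chen s s s le_rfl le_rfl
  have e : tmul ((𝓧.X s - 𝓧.X s : suppHolder d α R) : HolderSpace d (Vec d) α)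
      ((𝓧.X s - 𝓧.X s : suppHolder d α R) : HolderSpace d (Vec d) α) = 0 := by
    ext x y i
    obtain ⟨i, j⟩ := i
    rw [tmul_apply]
    simp
  rw [e] at h1
  simpa using h1

/-- The distance `|X - Y|_{C^γ} + |𝕏 - 𝕐|_{C^{2γ}}`. -/
instance : EMetricSpace (RoughPath T γ α R d) where
  edist 𝓧 𝓨 := timeENorm γ (incr 𝓧.X - incr 𝓨.X) + timeENorm (2 * γ) (𝓧.XX - 𝓨.XX)
  edist_self 𝓧 := by simp [timeENorm_zero]
  edist_comm 𝓧 𝓨 := by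
    rw [← timeENorm_neg, ← timeENorm_neg (𝓧.XX - 𝓨.XX), neg_sub, neg_sub]
  edist_triangle 𝓧 𝓨 𝓩 := by
    rw [← sub_add_sub_cancel (incr 𝓧.X) (incr 𝓨.X), ← sub_add_sub_cancel 𝓧.XX 𝓨.XX,
      add_add_add_comm]
    exact add_le_add (timeENorm_add_le _ _) (timeENorm_add_le _ _)
  eq_of_edist_eq_zero {𝓧 𝓨} h := by
    obtain ⟨h1, h2⟩ := add_eq_zero.1 h
    have e1 : 𝓧.X = 𝓨.X := by
      funext t
      have h0 : (0 : ℝ) ∈ Icc 0 T := ⟨le_rfl, t.2.1.trans t.2.2⟩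
      rcases t.2.1.eq_or_lt with ht | ht
      · rw [𝓧.zero t ht.symm, 𝓨.zero t ht.symm]
      · have h3 := eq_zero_of_timeENorm h1 (p := ⟨(⟨0, h0⟩, t), t.2.1⟩) ht
        simpa [incr, 𝓧.zero ⟨0, h0⟩ rfl, 𝓨.zero ⟨0, h0⟩ rfl, sub_eq_zero] using h3
    have e2 : 𝓧.XX = 𝓨.XX := by
      funext p
      rcases p.2.eq_or_lt with hp | hp
      · rw [𝓧.XX_diag hp, 𝓨.XX_diag hp]
      · exact sub_eq_zero.1 (eq_zero_of_timeENorm h2 hp)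
    cases 𝓧
    cases 𝓨
    cases e1
    cases e2
    rfl

/-- The rough path space is equipped with its Borel `σ`-algebra. -/
instance : MeasurableSpace (RoughPath T γ α R d) := borel _

instance : BorelSpace (RoughPath T γ α R d) := ⟨rfl⟩

theorem edist_def (𝓧 𝓨 : RoughPath T γ α R d) : edist 𝓧 𝓨 =
    timeENorm γ (incr 𝓧.X - incr 𝓨.X) + timeENorm (2 * γ) (𝓧.XX - 𝓨.XX) := rfl

theorem edist_lt_top (𝓧 𝓨 : RoughPath T γ α R d) : edist 𝓧 𝓨 < ∞ :=
  ENNReal.add_lt_top.2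
    ⟨(timeENorm_sub_le _ _).trans_lt (ENNReal.add_lt_top.2 ⟨𝓧.holder_fst, 𝓨.holder_fst⟩),
      (timeENorm_sub_le _ _).trans_lt (ENNReal.add_lt_top.2 ⟨𝓧.holder_snd, 𝓨.holder_snd⟩)⟩

variable {γ' α' : ℝ}

/-- The embedding of rough path spaces for `γ' ≤ γ` and `0 < α' ≤ α`. -/
def incl (hγ : γ' ≤ γ) (h0 : 0 < α') (hα : α' ≤ α) (𝓧 : RoughPath T γ α R d) :
    RoughPath T γ' α' R d where
  X t := suppIncl h0 hα (𝓧.X t)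
  XX p := tensorIncl h0 hα (𝓧.XX p)
  zero t ht := by rw [𝓧.zero t ht, map_zero]
  holder_fst := by
    refine (timeENorm_le_mul (Z := incr 𝓧.X) (C := ‖suppIncl (d := d) (R := R) h0 hα‖ₑ) hγ
      fun p => ?_).trans_lt
      (ENNReal.mul_lt_top (ENNReal.mul_lt_top enorm_lt_top ENNReal.ofReal_lt_top) 𝓧.holder_fst)
    simp only [incr]
    rw [← map_sub]
    exact (suppIncl h0 hα).le_opENorm _
  holder_snd :=
    (timeENorm_le_mul (Z := 𝓧.XX) (C := ‖tensorIncl (d := d) (R := R) h0 hα‖ₑ)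
      (mul_le_mul_of_nonneg_left hγ zero_le_two) fun p =>
        (tensorIncl h0 hα).le_opENorm (𝓧.XX p)).trans_lt
      (ENNReal.mul_lt_top (ENNReal.mul_lt_top enorm_lt_top ENNReal.ofReal_lt_top) 𝓧.holder_snd)
  chen s u t hsu hut := by
    have h := congrArg (biIncl h0 hα) (𝓧.chen s u t hsu hut)
    rw [map_sub, map_sub, biIncl_tmul] at h
    rw [← map_sub, ← map_sub]
    exact h

end RoughPath

/-- The intersection `𝒞^{γ-}([0,T], C_R^{α-})` of the spaces `𝒞^{γ'}([0,T], C_R^{α'})` over all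
`0 < γ' < γ` and `0 < α' < α`: pairs of functions `X_t(x)` and `𝕏_{s,t}(x, y)` which define a rough
path in each of these spaces. -/
structure RoughPathMinus (T γ α R : ℝ) (d : ℕ) where
  X : Icc (0 : ℝ) T → Vec d → Vec d
  XX : Simplex T → Vec d → Vec d → Mat d
  exists_roughPath : ∀ γ' α' : ℝ, 0 < γ' → γ' < γ → 0 < α' → α' < α →
    ∃ 𝓨 : RoughPath T γ' α' R d, (∀ t x, (𝓨.X t : HolderSpace d (Vec d) α') x = X t x) ∧
      ∀ p x y, (𝓨.XX p : BiHolder d α') x y = XX p x y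

namespace RoughPathMinus

variable {T γ α R : ℝ} {d : ℕ}

/-- The inclusion of `𝒞^{γ-}([0,T], C_R^{α-})` in `𝒞^{γ'}([0,T], C_R^{α'})`. -/
def toRoughPath {γ' α' : ℝ} (hγ0 : 0 < γ') (hγ : γ' < γ) (hα0 : 0 < α') (hα : α' < α)
    (𝓧 : RoughPathMinus T γ α R d) : RoughPath T γ' α' R d :=
  (𝓧.exists_roughPath γ' α' hγ0 hγ hα0 hα).choose

theorem toRoughPath_X {γ' α' : ℝ} (hγ0 : 0 < γ') (hγ : γ' < γ) (hα0 : 0 < α') (hα : α' < α)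
    (𝓧 : RoughPathMinus T γ α R d) (t : Icc (0 : ℝ) T) (x : Vec d) :
    ((𝓧.toRoughPath hγ0 hγ hα0 hα).X t : HolderSpace d (Vec d) α') x = 𝓧.X t x :=
  (𝓧.exists_roughPath γ' α' hγ0 hγ hα0 hα).choose_spec.1 t x

theorem toRoughPath_XX {γ' α' : ℝ} (hγ0 : 0 < γ') (hγ : γ' < γ) (hα0 : 0 < α') (hα : α' < α)
    (𝓧 : RoughPathMinus T γ α R d) (p : Simplex T) (x y : Vec d) :
    ((𝓧.toRoughPath hγ0 hγ hα0 hα).XX p : BiHolder d α') x y = 𝓧.XX p x y :=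
  (𝓧.exists_roughPath γ' α' hγ0 hγ hα0 hα).choose_spec.2 p x y

/-- The projective limit topology: the coarsest one for which all the inclusions in the spaces
`𝒞^{γ'}([0,T], C_R^{α'})` are continuous. -/
instance : TopologicalSpace (RoughPathMinus T γ α R d) :=
  ⨅ (γ' : ℝ) (α' : ℝ) (hγ0 : 0 < γ') (hγ : γ' < γ) (hα0 : 0 < α') (hα : α' < α),
    TopologicalSpace.induced (toRoughPath hγ0 hγ hα0 hα) inferInstance

/-- The space is equipped with its Borel `σ`-algebra. -/
instance : MeasurableSpace (RoughPathMinus T γ α R d) := borel _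

instance : BorelSpace (RoughPathMinus T γ α R d) := ⟨rfl⟩

/-- The embedding of `𝒞^γ([0,T], C_R^α)` in `𝒞^{γ-}([0,T], C_R^{α-})`. -/
def ofRoughPath (𝓧 : RoughPath T γ α R d) : RoughPathMinus T γ α R d where
  X t x := (𝓧.X t : HolderSpace d (Vec d) α) x
  XX p x y := (𝓧.XX p : BiHolder d α) x y
  exists_roughPath _ _ _ hγ hα0 hα :=
    ⟨𝓧.incl hγ.le hα0 hα.le, fun _ _ => rfl, fun _ _ _ => rfl⟩

/-- The space-time evaluation `(X_t(x₁), 𝕏_{0,t}(x₁, x₂))`. -/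
def eval (t : Icc (0 : ℝ) T) (x₁ x₂ : Vec d) (𝓧 : RoughPathMinus T γ α R d) : Vec d × Mat d :=
  (𝓧.X t x₁, 𝓧.XX ⟨(⟨0, le_rfl, t.2.1.trans t.2.2⟩, t), t.2.1⟩ x₁ x₂)

/-- Two laws on `𝒞^{γ-}([0,T], C_R^{α-})` have the same finite-dimensional space-time
distributions. -/
def SameFDD (μ ν : Measure (RoughPathMinus T γ α R d)) : Prop :=
  ∀ (m : ℕ) (t : Fin m → Icc (0 : ℝ) T) (x₁ x₂ : Fin m → Vec d), StrictMono t →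
    μ.map (fun 𝓧 (j : Fin m) => eval (t j) (x₁ j) (x₂ j) 𝓧) =
      ν.map (fun 𝓧 (j : Fin m) => eval (t j) (x₁ j) (x₂ j) 𝓧)

/-- `μ` is a weak limit point of the random variables `𝓧 n` in `𝒞^{γ-}([0,T], C_R^{α-})`: a
subsequence of `𝓧 n` converges weakly to a random variable with law `μ`. -/
def IsWeakLimitPoint {Ω : ℕ → Type*} [∀ n, MeasurableSpace (Ω n)] (P : ∀ n, Measure (Ω n))
    [∀ n, IsProbabilityMeasure (P n)] (𝓧 : ∀ n, Ω n → RoughPathMinus T γ α R d)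
    (μ : Measure (RoughPathMinus T γ α R d)) [IsProbabilityMeasure μ] : Prop :=
  ∃ φ : ℕ → ℕ, StrictMono φ ∧
    TendstoInDistribution (fun k => 𝓧 (φ k)) atTop id (fun k => P (φ k)) μ

end RoughPathMinus

end RoughHolder

end

noncomputable section

namespace RoughHolder

/-! The proof is Prokhorov's argument: tightness, then identification of the limit points. The
moment bound makes the laws tight by Markov's inequality, provided that bounded sets of `𝒞^γ([0,T],
C_R^α)` lie in compact sets of the projective limit (`isCompact_boundedSet`).

That compactness is Arzelà–Ascoli with interpolation, in space and then in time. In space, a family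
bounded in `C^α` and supported in a fixed ball has equi-Hölder derivatives. Pointwise limits of
these derivatives along an ultrafilter are therefore uniform, and since `α' < α`, smallness in the
sup norm and boundedness in `C^α` give smallness in `C^{α'}` (`exists_tendsto_holderSpace`). The
tensor space uses this twice, because the values of the outer function lie in an
infinite-dimensional Hölder space. In time, Chen's relation makes `𝕏` equi-Hölder on the compact
simplex (`exists_norm_XX_sub_le`), and the same interpolation applies with `γ' < γ`
(`RoughPath.exists_tendsto_incl`). Limits at different exponents are glued because all are limits of
the same pointwise values.

Neither separability nor completeness of the rough path space is used. Instead, countably many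
space-time evaluations form a continuous injection `evalSeq` into a separable metrizable space. It
yields a sequential Prokhorov theorem (`isSeqCompact_setOf_measure_compl_le`), and it shows that a
law concentrated on a `σ`-compact set is determined by its image (`measure_eq_of_map_eq`). The
finite-dimensional distributions determine that image (`SameFDD.map_evalSeq_eq`), so all limit
points coincide, and the whole sequence converges. -/

/-! ### Interpolation and uniform convergence -/

/-- If `a ≤ M r^β` and `a` is small, then `a / r^{β'}` is small, uniformly in `r`. -/
theorem exists_small_of_le_rpow {β β' ε : ℝ} (hβ' : 0 ≤ β') (h : β' < β) (M : ℝ) (hε : 0 < ε) :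
    ∃ η > 0, ∀ a r : ℝ, 0 < r → a ≤ M * r ^ β → a ≤ η → a ≤ ε * r ^ β' := by
  have hM : 0 < |M| + 1 := by positivity
  have hb : 0 < β - β' := sub_pos.2 h
  -- The threshold solves `(|M| + 1) δ^(β - β') = ε`: below it the bound by `M r^β` suffices, above
  -- it the bound by `η = ε δ^β'` does.
  set δ : ℝ := (ε / (|M| + 1)) ^ (β - β')⁻¹ with hδ
  have hq : 0 < ε / (|M| + 1) := by positivity
  have hδ0 : 0 < δ := Real.rpow_pos_of_pos hq _
  have hδe : δ ^ (β - β') = ε / (|M| + 1) := Real.rpow_inv_rpow hq.le hb.ne'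
  refine ⟨ε * δ ^ β', by positivity, fun a r hr h1 h2 => ?_⟩
  rcases le_total r δ with hrd | hrd
  · have h3 : r ^ (β - β') ≤ ε / (|M| + 1) := hδe ▸ Real.rpow_le_rpow hr.le hrd hb.le
    have h4 : r ^ β = r ^ (β - β') * r ^ β' := by rw [← Real.rpow_add hr]; ring_nf
    have hp : 0 < r ^ β' := Real.rpow_pos_of_pos hr _
    calc a ≤ M * r ^ β := h1
      _ ≤ (|M| + 1) * r ^ β := by
          have := le_abs_self M
          gcongr
          linarith
      _ = (|M| + 1) * r ^ (β - β') * r ^ β' := by rw [h4]; ring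
      _ ≤ (|M| + 1) * (ε / (|M| + 1)) * r ^ β' := by gcongr
      _ = ε * r ^ β' := by rw [mul_div_cancel₀ _ hM.ne']
  · refine h2.trans ?_
    gcongr

/-- Pointwise convergence of eventually equi-Hölder functions on a compact set is uniform. -/
theorem tendstoUniformlyOn_of_dist_le {X V ι : Type*} [PseudoMetricSpace X] [PseudoMetricSpace V]
    {l : Filter ι} [l.NeBot] {s : Set X} (hs : IsCompact s) {F : ι → X → V} {f : X → V} {C β : ℝ}
    (hβ : 0 < β) (hF : ∀ᶠ i in l, ∀ x ∈ s, ∀ y ∈ s, dist (F i x) (F i y) ≤ C * dist x y ^ β)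
    (hf : ∀ x ∈ s, Tendsto (fun i => F i x) l (𝓝 (f x))) : TendstoUniformlyOn F f l s := by
  rw [Metric.tendstoUniformlyOn_iff]
  intro ε hε
  -- The limit inherits the Hölder bound, so convergence on a finite `δ`-net controls all points
  -- with three errors of size `ε / 4`.
  have hlim : ∀ x ∈ s, ∀ y ∈ s, dist (f x) (f y) ≤ C * dist x y ^ β := fun x hx y hy =>
    le_of_tendsto ((hf x hx).dist (hf y hy)) (hF.mono fun i hi => hi x hx y hy)
  obtain ⟨δ, hδ, hδε⟩ : ∃ δ > 0, ∀ r : ℝ, 0 ≤ r → r < δ → C * r ^ β < ε / 4 := by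
    have hc : Tendsto (fun r : ℝ => C * r ^ β) (𝓝 0) (𝓝 (C * 0 ^ β)) :=
      (Real.continuousAt_rpow_const 0 β (Or.inr hβ.le)).const_mul C
    rw [Real.zero_rpow hβ.ne', mul_zero] at hc
    obtain ⟨δ, hδ, h⟩ := Metric.eventually_nhds_iff.1 (hc.eventually_lt_const (by positivity :
      (0 : ℝ) < ε / 4))
    exact ⟨δ, hδ, fun r h0 hr => h (by rwa [Real.dist_eq, sub_zero, abs_of_nonneg h0])⟩
  obtain ⟨t, hts, htf, hcov⟩ := hs.finite_cover_balls hδ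
  have hpt : ∀ᶠ i in l, ∀ z ∈ t, dist (F i z) (f z) < ε / 4 :=
    (eventually_all_finite htf).2 fun z hz => Metric.tendsto_nhds.1 (hf z (hts hz)) _ (by positivity)
  filter_upwards [hpt, hF] with i h1 h2 x hx
  obtain ⟨z, hz, hxz⟩ := mem_iUnion₂.1 (hcov hx)
  have hxz' : dist x z < δ := hxz
  have hzs := hts hz
  have e1 := (hlim x hx z hzs).trans_lt (hδε _ dist_nonneg hxz')
  have e2 := (h2 x hx z hzs).trans_lt (hδε _ dist_nonneg hxz')
  have e3 := h1 z hz
  have e4 := dist_triangle4_right (f x) (F i x) (f z) (F i z)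
  rw [dist_comm (f z) (F i z)] at e4
  linarith

/-! ### Limits of functions whose partial derivatives converge uniformly -/

section Limits

variable {d : ℕ} {F : Type*} [NormedAddCommGroup F] [NormedSpace ℝ F]

/-- The monomial `v ↦ ∏ i, (v i)_{j i}`. -/
def coordMonomial {k : ℕ} (j : Fin k → Fin d) :
    ContinuousMultilinearMap ℝ (fun _ : Fin k => Vec d) ℝ :=
  (ContinuousMultilinearMap.mkPiAlgebra ℝ (Fin k) ℝ).compContinuousLinearMap
    fun i => EuclideanSpace.proj (j i)

theorem coordMonomial_apply {k : ℕ} (j : Fin k → Fin d) (v : Fin k → Vec d) :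
    coordMonomial j v = ∏ i, v i (j i) := rfl

/-- Expand each argument in the standard basis. This transfers uniform convergence from the partial
derivatives, which the Hölder norm sees, to the full derivatives `iteratedFDeriv`. -/
theorem multilinear_eq_sum {k : ℕ} (A : ContinuousMultilinearMap ℝ (fun _ : Fin k => Vec d) F) :
    A = ∑ j : Fin k → Fin d,
      (coordMonomial j).smulRight (A fun i => EuclideanSpace.single (j i) 1) := by
  ext v
  have hv : ∀ i, v i = ∑ m, v i m • EuclideanSpace.single m (1 : ℝ) := by
    intro i
    ext m
    simp [Finset.sum_apply, Pi.single_apply]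
  have h := A.map_sum fun i m => v i m • EuclideanSpace.single m (1 : ℝ)
  simp only [← hv, A.map_smul_univ] at h
  rw [h, sum_apply]
  rfl

theorem iteratedFDeriv_eq_sum (k : ℕ) (f : Vec d → F) (x : Vec d) :
    iteratedFDeriv ℝ k f x = ∑ j : Fin k → Fin d, (coordMonomial j).smulRight (partialD j f x) :=
  multilinear_eq_sum _

/-- If all the partial derivatives up to order `m` converge uniformly, then the limit is of class
`C^m` and its partial derivatives are the limits. -/
theorem contDiff_of_tendstoUniformly_partialD {ι : Type*} {l : Filter ι} [l.NeBot] {m : ℕ}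
    {f : ι → Vec d → F} (hf : ∀ i, ContDiff ℝ m (f i))
    {D : ∀ k : ℕ, (Fin k → Fin d) → Vec d → F}
    (hD : ∀ k ≤ m, ∀ j : Fin k → Fin d, TendstoUniformly (fun i => partialD j (f i)) (D k j) l) :
    ContDiff ℝ m (D 0 Fin.elim0) ∧
      ∀ k ≤ m, ∀ (j : Fin k → Fin d) (x : Vec d), partialD j (D 0 Fin.elim0) x = D k j x := by
  -- The candidate Taylor series, assembled from the limits of the partial derivatives.
  -- Differentiation under uniform limits shows that it is one for `D 0`, and uniqueness of the
  -- derivatives identifies its coefficients.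
  set p : Vec d → FormalMultilinearSeries ℝ (Vec d) F := fun x k =>
    ∑ j : Fin k → Fin d, (coordMonomial j).smulRight (D k j x) with hp
  have hu : ∀ k ≤ m, TendstoUniformly (fun i => iteratedFDeriv ℝ k (f i)) (fun x => p x k) l := by
    intro k hk
    have h : ∀ s : Finset (Fin k → Fin d), TendstoUniformly
        (fun i x => ∑ j ∈ s, (coordMonomial j).smulRight (partialD j (f i) x))
        (fun x => ∑ j ∈ s, (coordMonomial j).smulRight (D k j x)) l := by
      intro s
      induction s using Finset.cons_induction with
      | empty =>
        simp only [Finset.sum_empty]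
        exact tendstoUniformly_iff_tendsto.2 (by simpa using! tendsto_diag_uniformity _ _)
      | cons j s hj ih =>
        simp only [Finset.sum_cons]
        exact ((ContinuousMultilinearMap.smulRightL ℝ (fun _ : Fin k => Vec d) F
          (coordMonomial j)).uniformContinuous.comp_tendstoUniformly (hD k hk j)).add ih
    simpa only [← iteratedFDeriv_eq_sum] using h Finset.univ
  have hT : HasFTaylorSeriesUpTo m (D 0 Fin.elim0) p := by
    refine ⟨fun x => ?_, fun k hk x => ?_, fun k hk => ?_⟩
    · simp only [hp, ContinuousMultilinearMap.curry0_apply, sum_apply]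
      rw [Fintype.sum_eq_single (Fin.elim0 : Fin 0 → Fin d)
        (fun j hj => absurd (Subsingleton.elim _ _) hj)]
      change coordMonomial (Fin.elim0 : Fin 0 → Fin d) (0 : Fin 0 → Vec d) • D 0 Fin.elim0 x = _
      rw [coordMonomial_apply, Finset.univ_eq_empty, Finset.prod_empty, one_smul]
    · have hk' : k < m := by exact_mod_cast hk
      refine hasFDerivAt_of_tendstoUniformly (l := l) (f := fun i => iteratedFDeriv ℝ k (f i))
        (f' := fun i x => (iteratedFDeriv ℝ (k + 1) (f i) x).curryLeft)
        (g' := fun x => (p x (k + 1)).curryLeft) ?_ ?_ ?_ x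
      · exact (continuousMultilinearCurryLeftEquiv ℝ (fun _ : Fin (k + 1) => Vec d)
          F).toContinuousLinearEquiv.toContinuousLinearMap.uniformContinuous.comp_tendstoUniformly
          (hu (k + 1) hk')
      · exact fun i x => (contDiff_iff_ftaylorSeries.1 (hf i)).fderiv k hk x
      · exact fun x => (hu k hk'.le).tendsto_at x
    · have hk' : k ≤ m := by exact_mod_cast hk
      exact (hu k hk').continuous (Frequently.of_forall fun i =>
        (hf i).continuous_iteratedFDeriv (by exact_mod_cast hk'))
  refine ⟨hT.contDiff, fun k hk j x => ?_⟩
  have hk' : (k : WithTop ℕ∞) ≤ (m : ℕ) := by exact_mod_cast hk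
  refine tendsto_nhds_unique ?_ ((hD k hk j).tendsto_at x)
  have h1 := (hu k hk).tendsto_at x
  rw [hT.eq_iteratedFDeriv hk' x] at h1
  exact ((ContinuousMultilinearMap.apply ℝ (fun _ : Fin k => Vec d) F
    fun i => EuclideanSpace.single (j i) 1).continuous.tendsto _).comp h1

end Limits

/-! ### Compactness of the embeddings of Hölder spaces -/

section Compactness

variable {d : ℕ} {E F : Type*} [NormedAddCommGroup E] [NormedSpace ℝ E]
  [NormedAddCommGroup F] [NormedSpace ℝ F] {α α' : ℝ}

theorem partialD_clm_comp {n : ℕ} {f : Vec d → E} (hf : ContDiff ℝ n f) (L : E →L[ℝ] F) {k : ℕ}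
    (hk : k ≤ n) (j : Fin k → Fin d) (x : Vec d) :
    partialD j (fun x => L (f x)) x = L (partialD j f x) := by
  have := L.iteratedFDeriv_comp_left (hf.contDiffAt (x := x)) (i := k) (by exact_mod_cast hk)
  simp only [partialD]
  change iteratedFDeriv ℝ k (L ∘ f) x _ = _
  rw [this]
  rfl

theorem partialD_sub {n : ℕ} {f g : Vec d → E} (hf : ContDiff ℝ n f) (hg : ContDiff ℝ n g) {k : ℕ}
    (hk : k ≤ n) (j : Fin k → Fin d) (x : Vec d) :
    partialD j (f - g) x = partialD j f x - partialD j g x := by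
  simp only [partialD]
  rw [iteratedFDeriv_sub_apply ((hf.of_le (by exact_mod_cast hk)).contDiffAt)
    ((hg.of_le (by exact_mod_cast hk)).contDiffAt)]
  rfl

theorem tsupport_subset_closedBall {V : Type*} [Zero V] {R : ℝ} {f : Vec d → V}
    (hf : ∀ x, R < ‖x‖ → f x = 0) :
    tsupport f ⊆ Metric.closedBall 0 R :=
  closure_minimal (fun x hx => by
    rw [mem_closedBall_zero_iff]
    exact not_lt.1 fun h => hx (hf x h)) Metric.isClosed_closedBall

theorem partialD_eq_zero {R : ℝ} {f : Vec d → E} (hf : ∀ x, R < ‖x‖ → f x = 0) {k : ℕ}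
    (j : Fin k → Fin d) {x : Vec d} (hx : R < ‖x‖) : partialD j f x = 0 := by
  have h : iteratedFDeriv ℝ k f x = 0 := by
    by_contra h
    have := tsupport_subset_closedBall hf (support_iteratedFDeriv_subset k h)
    rw [mem_closedBall_zero_iff] at this
    exact this.not_gt hx
  simp [partialD, h]

theorem HolderSpace.norm_partialD_le (f : HolderSpace d E α) {k : ℕ} (hk : k ≤ ⌊α⌋₊)
    (j : Fin k → Fin d) (x : Vec d) : ‖partialD j f x‖ ≤ ‖f‖ := by
  have h := ENNReal.toReal_mono f.holderENorm_lt_top.ne (enorm_partialD_le hk j f x)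
  rwa [toReal_enorm] at h

theorem HolderSpace.norm_apply_le (f : HolderSpace d E α) (x : Vec d) : ‖f x‖ ≤ ‖f‖ := by
  have h := ENNReal.toReal_mono f.holderENorm_lt_top.ne (enorm_apply_le (α := α) f x)
  rwa [toReal_enorm] at h

/-- The partial derivatives up to order `⌊α'⌋` of functions in `C_b^α` satisfy a Hölder condition
with an exponent larger than `α' - ⌊α'⌋`. -/
theorem HolderSpace.exists_dist_partialD_le (hα : α' < α) {k : ℕ}
    (hk : k ≤ ⌊α'⌋₊) :
    ∃ C β : ℝ, 0 ≤ C ∧ α' - ⌊α'⌋₊ < β ∧ ∀ (f : HolderSpace d E α) (j : Fin k → Fin d) (x y : Vec d),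
      ‖partialD j f x - partialD j f y‖ ≤ C * ‖f‖ * dist x y ^ β := by
  have hfl : ⌊α'⌋₊ ≤ ⌊α⌋₊ := Nat.floor_mono hα.le
  -- Below the top order `⌊α⌋` the mean value inequality gives exponent `1`. At the top order `k =
  -- ⌊α⌋` the two floors agree, and the exponent `α - ⌊α⌋` is the larger one because `α' < α`.
  rcases (hk.trans hfl).lt_or_eq with hlt | rfl
  · refine ⟨d, 1, Nat.cast_nonneg d, by linarith [Nat.lt_floor_add_one α'], fun f j x y => ?_⟩
    rw [Real.rpow_one]
    exact norm_partialD_sub_le_dist f.contDiff (fun hk j x => f.norm_partialD_le hk j x) hlt j x y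
  · have hm : ⌊α⌋₊ = ⌊α'⌋₊ := le_antisymm hk hfl
    refine ⟨1, α - ⌊α⌋₊, zero_le_one, by rw [hm]; linarith, fun f j x y => ?_⟩
    rcases eq_or_ne x y with rfl | hxy
    · rw [sub_self, norm_zero, one_mul]
      positivity
    have hq := (div_le_holderPart j f hxy).trans
      (le_add_self : holderPart α f ≤ holderENorm α f)
    have hrp : 0 < dist x y ^ (α - ⌊α⌋₊) := Real.rpow_pos_of_pos (dist_pos.2 hxy) _
    rw [ENNReal.div_le_iff (by simpa using hrp) ENNReal.ofReal_ne_top] at hq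
    change _ ≤ holderENorm α (f : Vec d → E) * _ at hq
    rw [← f.enorm_eq, ← ofReal_norm, ← ofReal_norm, ← ENNReal.ofReal_mul (norm_nonneg _),
      ENNReal.ofReal_le_ofReal_iff (by positivity)] at hq
    rwa [one_mul]

theorem holderENorm_le_of_norm_le {f : Vec d → F} {ε : ℝ} (hε : 0 ≤ ε)
    (h1 : ∀ k ≤ ⌊α⌋₊, ∀ (j : Fin k → Fin d) x, ‖partialD j f x‖ ≤ ε)
    (h2 : ∀ (j : Fin ⌊α⌋₊ → Fin d) x y, x ≠ y →
      ‖partialD j f x - partialD j f y‖ ≤ ε * dist x y ^ (α - ⌊α⌋₊)) :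
    holderENorm α f ≤ ENNReal.ofReal (2 * ε) := by
  rw [two_mul, ENNReal.ofReal_add hε hε]
  refine add_le_add ?_ ?_
  · refine iSup_le fun k => iSup_le fun hk => iSup_le fun j => iSup_le fun x => ?_
    rw [← ofReal_norm]
    exact ENNReal.ofReal_le_ofReal (h1 k hk j x)
  · refine iSup_le fun j => iSup_le fun x => iSup_le fun y => iSup_le fun hxy => ?_
    have hrp : 0 < dist x y ^ (α - ⌊α⌋₊) := Real.rpow_pos_of_pos (dist_pos.2 hxy) _
    rw [ENNReal.div_le_iff (by simpa using hrp) ENNReal.ofReal_ne_top, ← ENNReal.ofReal_mul hε,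
      ← ofReal_norm]
    exact ENNReal.ofReal_le_ofReal (h2 j x y hxy)

/-- A bounded set of functions in `C_b^α` with supports in a fixed ball is relatively compact in
`C_b^{α'}` for `α' < α`, after composition with a linear map `L` which maps bounded sets of
(derivatives of) values to relatively compact ones. -/
theorem exists_tendsto_holderSpace (h0 : 0 < α') (hα : α' < α) {L : E →L[ℝ] F} {S : Set E}
    (hL : ∀ (M : ℝ) (U : Ultrafilter E), (∀ᶠ e in (U : Filter E), e ∈ S ∧ ‖e‖ ≤ M) →
      ∃ y, Tendsto L U (𝓝 y)) {M R : ℝ} (U : Ultrafilter (HolderSpace d E α))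
    (hM : ∀ᶠ u in (U : Filter (HolderSpace d E α)), ‖u‖ ≤ M)
    (hR : ∀ᶠ u in (U : Filter (HolderSpace d E α)), ∀ x, R < ‖x‖ → u x = 0)
    (hS : ∀ᶠ u : HolderSpace d E α in (U : Filter (HolderSpace d E α)),
      ∀ k ≤ ⌊α⌋₊, ∀ (j : Fin k → Fin d) x, partialD j u x ∈ S) :
    ∃ v : HolderSpace d F α',
      Tendsto (fun u => HolderSpace.incl h0 hα.le (HolderSpace.clmComp L u)) U (𝓝 v) := by
  have hfl : ⌊α'⌋₊ ≤ ⌊α⌋₊ := Nat.floor_mono hα.le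
  -- The ultrafilter supplies the limits of all derivatives at all points at once. Orders above
  -- `⌊α'⌋` get the irrelevant value `0`, only to make `D` total.
  have hlim : ∀ (k : ℕ) (j : Fin k → Fin d) (x : Vec d), ∃ y : F, k ≤ ⌊α'⌋₊ →
      Tendsto (fun u : HolderSpace d E α => L (partialD j u x)) U (𝓝 y) := by
    intro k j x
    by_cases hk : k ≤ ⌊α'⌋₊
    · obtain ⟨y, hy⟩ := hL M (U.map fun u : HolderSpace d E α => partialD j u x) (by
        rw [Ultrafilter.coe_map, eventually_map]
        filter_upwards [hM, hS] with u h1 h2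
        exact ⟨h2 k (hk.trans hfl) j x, (u.norm_partialD_le (hk.trans hfl) j x).trans h1⟩)
      exact ⟨y, fun _ => hy⟩
    · exact ⟨0, fun h => absurd h hk⟩
  choose D hD using hlim
  have hM0 : 0 ≤ M := by
    obtain ⟨u, hu⟩ := hM.exists
    exact (norm_nonneg u).trans hu
  -- the Hölder bounds
  have hH : ∀ k ≤ ⌊α'⌋₊, ∃ C β : ℝ, 0 ≤ C ∧ α' - ⌊α'⌋₊ < β ∧
      ∀ᶠ u : HolderSpace d E α in (U : Filter (HolderSpace d E α)),
        ∀ (j : Fin k → Fin d) (x y : Vec d),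
        ‖L (partialD j u x) - L (partialD j u y)‖ ≤ C * dist x y ^ β := by
    intro k hk
    obtain ⟨C, β, hC, hβ, h⟩ := HolderSpace.exists_dist_partialD_le (d := d) (E := E) hα hk
    refine ⟨‖L‖ * (C * M), β, by positivity, hβ, ?_⟩
    filter_upwards [hM] with u hu j x y
    rw [← map_sub]
    calc _ ≤ ‖L‖ * ‖partialD j u x - partialD j u y‖ := L.le_opNorm _
      _ ≤ ‖L‖ * (C * ‖u‖ * dist x y ^ β) := by gcongr; exact h u j x y
      _ ≤ ‖L‖ * (C * M * dist x y ^ β) := by gcongr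
      _ = _ := by ring
  have hβ' : 0 ≤ α' - ⌊α'⌋₊ := sub_nonneg.2 (Nat.floor_le h0.le)
  -- On the closed ball this is Arzelà–Ascoli. Outside it the derivatives vanish, and so do their
  -- limits.
  have hunif : ∀ k ≤ ⌊α'⌋₊, ∀ j : Fin k → Fin d,
      TendstoUniformly (fun (u : HolderSpace d E α) x => L (partialD j u x)) (D k j) U := by
    intro k hk j
    obtain ⟨C, β, hC, hβ, h⟩ := hH k hk
    have h1 : TendstoUniformlyOn (fun (u : HolderSpace d E α) x => L (partialD j u x)) (D k j) U
        (Metric.closedBall 0 R) :=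
      tendstoUniformlyOn_of_dist_le (isCompact_closedBall 0 R) (hβ'.trans_lt hβ) (C := C)
        (h.mono fun u hu x _ y _ => by rw [dist_eq_norm]; exact hu j x y) fun x _ => hD k j x hk
    rw [Metric.tendstoUniformly_iff]
    intro ε hε
    filter_upwards [Metric.tendstoUniformlyOn_iff.1 h1 ε hε, hR] with u h2 h3 x
    by_cases hx : ‖x‖ ≤ R
    · exact h2 x (mem_closedBall_zero_iff.2 hx)
    · rw [not_le] at hx
      have h4 : D k j x = 0 := by
        refine tendsto_nhds_unique (hD k j x hk) (tendsto_const_nhds.congr' ?_)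
        filter_upwards [hR] with u hu
        rw [partialD_eq_zero hu j hx, map_zero]
      rw [h4, partialD_eq_zero h3 j hx, map_zero, dist_self]
      exact hε
  have hcd : ∀ u : HolderSpace d E α, ContDiff ℝ ⌊α'⌋₊ fun x => L (u x) := fun u =>
    L.contDiff.comp (u.contDiff.of_le (by exact_mod_cast hfl))
  have hcd' : ∀ u : HolderSpace d E α, ContDiff ℝ ⌊α'⌋₊ u := fun u =>
    u.contDiff.of_le (by exact_mod_cast hfl)
  obtain ⟨hv, hvD⟩ := contDiff_of_tendstoUniformly_partialD (f := fun (u : HolderSpace d E α) x =>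
    L (u x)) (D := D) hcd fun k hk j => by
      have := hunif k hk j
      convert this using 3 with u
      exact partialD_clm_comp (hcd' u) L hk j _
  set v := D 0 Fin.elim0 with hvdef
  have hdiff : ∀ k ≤ ⌊α'⌋₊, ∀ (j : Fin k → Fin d) (u : HolderSpace d E α) x,
      partialD j ((fun x => L (u x)) - v) x = L (partialD j u x) - D k j x := fun k hk j u x => by
    rw [partialD_sub (hcd u) hv hk, partialD_clm_comp (hcd' u) L hk, hvD k hk]
  have hsmall : ∀ η > 0, ∀ᶠ u in (U : Filter (HolderSpace d E α)), ∀ k ≤ ⌊α'⌋₊,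
      ∀ (j : Fin k → Fin d) x, ‖partialD j ((fun x => L (u x)) - v) x‖ ≤ η := by
    intro η hη
    refine (eventually_all_finite (finite_Iic ⌊α'⌋₊)).2 fun k (hk : k ≤ _) =>
      eventually_all.2 fun j => ?_
    filter_upwards [Metric.tendstoUniformly_iff.1 (hunif k hk j) η hη] with u hu x
    rw [hdiff k hk, ← dist_eq_norm, dist_comm]
    exact (hu x).le
  -- Only the Hölder seminorm of the top derivatives needs interpolation. The constant `2 * C`
  -- accounts for the function and its limit, both Hölder with constant `C` and exponent `β > α' -
  -- ⌊α'⌋`.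
  have key : ∀ ε > 0, ∀ᶠ u in (U : Filter (HolderSpace d E α)),
      holderENorm α' ((fun x => L (u x)) - v) ≤ ENNReal.ofReal (2 * ε) := by
    intro ε hε
    obtain ⟨C, β, hC, hβ, h⟩ := hH _ le_rfl
    obtain ⟨η, hη, hint⟩ := exists_small_of_le_rpow hβ' hβ (2 * C) hε
    filter_upwards [hsmall ε hε, hsmall (η / 2) (by positivity), h] with u h1 h2 h3
    refine holderENorm_le_of_norm_le hε.le h1 fun j x y hxy => ?_
    refine hint _ _ (dist_pos.2 hxy) ?_ ?_
    · have h4 : ‖D _ j x - D _ j y‖ ≤ C * dist x y ^ β :=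
        le_of_tendsto ((hD _ j x le_rfl).sub (hD _ j y le_rfl)).norm (h.mono fun u hu => hu j x y)
      rw [hdiff _ le_rfl, hdiff _ le_rfl, sub_sub_sub_comm]
      linarith [norm_sub_le (L (partialD j u x) - L (partialD j u y)) (D _ j x - D _ j y),
        h3 j x y]
    · linarith [norm_sub_le (partialD j ((fun x => L (u x)) - v) x)
        (partialD j ((fun x => L (u x)) - v) y), h2 _ le_rfl j x, h2 _ le_rfl j y]
  -- The limit has finite norm because it differs by a function of finite norm from a member of the
  -- space.
  have hmem : v ∈ holderSubmodule d F α' := by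
    obtain ⟨u, hu⟩ := (key 1 one_pos).exists
    have h1 : (fun x => L (u x)) ∈ holderSubmodule d F α' :=
      (HolderSpace.incl h0 hα.le (HolderSpace.clmComp L u)).2
    have h2 : (fun x => L (u x)) - v ∈ holderSubmodule d F α' :=
      ⟨(hcd u).sub hv, hu.trans_lt ENNReal.ofReal_lt_top⟩
    simpa using sub_mem h1 h2
  let v' : HolderSpace d F α' := ⟨v, hmem⟩
  refine ⟨v', ?_⟩
  rw [Metric.tendsto_nhds]
  intro ε hε
  filter_upwards [key (ε / 4) (by positivity)] with u hu
  rw [dist_eq_norm, HolderSpace.norm_def]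
  refine (ENNReal.toReal_le_of_le_ofReal (by positivity) hu).trans_lt ?_
  linarith

end Compactness

/-! ### Compactness of the embeddings of the supported spaces -/

section Supported

variable {d : ℕ} {E : Type*} [NormedAddCommGroup E] [NormedSpace ℝ E] {α α' R : ℝ}

/-- Evaluation at a point, as a continuous linear map. -/
def HolderSpace.evalCLM (x : Vec d) : HolderSpace d E α →L[ℝ] E :=
  LinearMap.mkContinuous
    { toFun := fun f => f x
      map_add' := fun _ _ => rfl
      map_smul' := fun _ _ => rfl } 1 fun f => by
      rw [one_mul]
      exact f.norm_apply_le x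

@[simp] theorem HolderSpace.evalCLM_apply (x : Vec d) (f : HolderSpace d E α) :
    HolderSpace.evalCLM x f = f x := rfl

theorem HolderSpace.tendsto_apply {ι : Type*} {l : Filter ι} {f : ι → HolderSpace d E α}
    {g : HolderSpace d E α} (h : Tendsto f l (𝓝 g)) (x : Vec d) :
    Tendsto (fun i => f i x) l (𝓝 (g x)) :=
  ((HolderSpace.evalCLM (α := α) x).continuous.tendsto g).comp h

/-- The closed ball is closed, so the support condition becomes a pointwise one, which passes to
limits. -/
theorem mem_suppHolder_iff {f : HolderSpace d (Vec d) α} :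
    f ∈ suppHolder d α R ↔ ∀ x, R < ‖x‖ → f x = 0 := by
  refine ⟨fun h x hx => ?_, fun h => tsupport_subset_closedBall h⟩
  by_contra hne
  have := h (subset_tsupport _ hne)
  rw [mem_closedBall_zero_iff] at this
  exact this.not_gt hx

theorem tmul_apply_eq (f g : HolderSpace d (Vec d) α) (x y : Vec d) :
    tmul f g x y = outer d (f x) (g y) := rfl

/-- Evaluation at `(x, y)` is continuous and linear, and its closed kernel contains the elementary
tensors that span. -/
theorem suppTensor_apply_eq_zero {u : BiHolder d α} (hu : u ∈ suppTensor d α R) {x y : Vec d}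
    (h : R < ‖x‖ ∨ R < ‖y‖) : u x y = 0 := by
  set e : BiHolder d α →L[ℝ] Mat d :=
    (HolderSpace.evalCLM (α := α) y).comp (HolderSpace.evalCLM (α := α) x)
  have hcl : suppTensor d α R ≤ LinearMap.ker (e : BiHolder d α →ₗ[ℝ] Mat d) := by
    refine Submodule.topologicalClosure_minimal _ (Submodule.span_le.2 ?_) e.isClosed_ker
    rintro _ ⟨f, hf, g, hg, rfl⟩
    change tmul f g x y = 0
    rw [tmul_apply_eq]
    rcases h with h | h
    · rw [mem_suppHolder_iff.1 hf x h, map_zero, LinearMap.zero_apply]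
    · rw [mem_suppHolder_iff.1 hg y h, map_zero]
  exact hcl hu

/-- With finite-dimensional values, bounded sets of values are already relatively compact, so the
general result applies with `L` the identity and no constraint `S`. -/
theorem exists_tendsto_incl [FiniteDimensional ℝ E] (h0 : 0 < α') (hα : α' < α) {M : ℝ}
    (U : Ultrafilter (HolderSpace d E α))
    (hM : ∀ᶠ u in (U : Filter (HolderSpace d E α)), ‖u‖ ≤ M)
    (hR : ∀ᶠ u in (U : Filter (HolderSpace d E α)), ∀ x, R < ‖x‖ → u x = 0) :
    ∃ v : HolderSpace d E α', Tendsto (HolderSpace.incl h0 hα.le) U (𝓝 v) := by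
  have : ProperSpace E := FiniteDimensional.proper ℝ E
  exact exists_tendsto_holderSpace h0 hα (L := ContinuousLinearMap.id ℝ E) (S := univ)
    (fun M U hU => by
      obtain ⟨y, -, hy⟩ := (isCompact_closedBall (0 : E) M).ultrafilter_le_nhds U
        (le_principal_iff.2 (hU.mono fun e he => mem_closedBall_zero_iff.2 he.2))
      exact ⟨y, hy⟩) U hM hR (Eventually.of_forall fun _ _ _ _ _ => mem_univ _)

theorem exists_tendsto_suppIncl (h0 : 0 < α') (hα : α' < α) {M : ℝ}
    (U : Ultrafilter (suppHolder d α R))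
    (hM : ∀ᶠ u in (U : Filter (suppHolder d α R)), ‖u‖ ≤ M) :
    ∃ v : suppHolder d α' R, Tendsto (suppIncl h0 hα.le) U (𝓝 v) := by
  obtain ⟨v, hv⟩ := exists_tendsto_incl (R := R) h0 hα
    (U.map (Subtype.val : suppHolder d α R → HolderSpace d (Vec d) α)) (M := M) hM
    (Eventually.of_forall (f := (U : Filter (suppHolder d α R)))
      fun u => mem_suppHolder_iff.1 u.2)
  rw [Ultrafilter.coe_map, tendsto_map'_iff] at hv
  have hmem : v ∈ suppHolder d α' R := mem_suppHolder_iff.2 fun x hx =>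
    tendsto_nhds_unique (HolderSpace.tendsto_apply hv x)
      (tendsto_const_nhds.congr fun u => (mem_suppHolder_iff.1 u.2 x hx).symm)
  exact ⟨⟨v, hmem⟩, tendsto_subtype_rng.2 hv⟩

/-- The general result is applied in the outer variable with `L` the inner embedding, which is
compact only on functions supported in a fixed ball. The set `S` records this support condition for
the values of `u` and of its derivatives. -/
theorem exists_tendsto_tensorIncl (h0 : 0 < α') (hα : α' < α) {M : ℝ}
    (U : Ultrafilter (suppTensor d α R))
    (hM : ∀ᶠ u in (U : Filter (suppTensor d α R)), ‖u‖ ≤ M) :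
    ∃ v : suppTensor d α' R, Tendsto (tensorIncl h0 hα.le) U (𝓝 v) := by
  obtain ⟨v, hv⟩ := exists_tendsto_holderSpace (d := d) (R := R) (M := M) h0 hα
    (L := (HolderSpace.incl h0 hα.le : HolderSpace d (Mat d) α →L[ℝ] HolderSpace d (Mat d) α'))
    (S := {g | ∀ y, R < ‖y‖ → g y = 0})
    (fun M U hU => exists_tendsto_incl h0 hα U (hU.mono fun _ h => h.2) (hU.mono fun _ h => h.1))
    (U.map (Subtype.val : suppTensor d α R → BiHolder d α)) hM
    (Eventually.of_forall (f := (U : Filter (suppTensor d α R))) fun u x hx => by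
      ext1 y
      exact suppTensor_apply_eq_zero u.2 (Or.inl hx))
    -- Evaluation at `y` commutes with derivatives in `x`, and `u(·, y)` vanishes identically for
    -- `|y| > R`.
    (Eventually.of_forall (f := (U : Filter (suppTensor d α R))) fun u k hk j x y hy => by
      have h := partialD_clm_comp (u : BiHolder d α).contDiff (HolderSpace.evalCLM (α := α) y) hk j x
      simp only [HolderSpace.evalCLM_apply, suppTensor_apply_eq_zero u.2 (Or.inr hy)] at h
      rw [← h]
      simp [partialD])
  rw [Ultrafilter.coe_map, tendsto_map'_iff] at hv
  have hmem : v ∈ suppTensor d α' R :=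
    (Submodule.isClosed_topologicalClosure _).mem_of_tendsto hv
      (Eventually.of_forall fun u => biIncl_mem_suppTensor h0 hα.le u.2)
  exact ⟨⟨v, hmem⟩, tendsto_subtype_rng.2 hv⟩

theorem HolderSpace.norm_clmComp_le {F : Type*} [NormedAddCommGroup F] [NormedSpace ℝ F]
    (L : E →L[ℝ] F) (f : HolderSpace d E α) : ‖HolderSpace.clmComp L f‖ ≤ ‖L‖ * ‖f‖ := by
  have h := ENNReal.toReal_mono (ENNReal.mul_lt_top enorm_lt_top f.holderENorm_lt_top).ne
    (holderENorm_clm_comp_le f.contDiff L)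
  rwa [ENNReal.toReal_mul, toReal_enorm] at h

variable (d α) in
-- Composition with a bounded linear map is used once in each variable; `K` is the norm of the
-- bilinear map `outer`.
theorem exists_norm_tmul_le :
    ∃ K : ℝ, 0 ≤ K ∧ ∀ f g : HolderSpace d (Vec d) α, ‖tmul f g‖ ≤ K * ‖f‖ * ‖g‖ := by
  set A : Vec d →L[ℝ] Vec d →L[ℝ] Mat d := LinearMap.toContinuousLinearMap
    ((LinearMap.toContinuousLinearMap :
      (Vec d →ₗ[ℝ] Mat d) ≃ₗ[ℝ] (Vec d →L[ℝ] Mat d)).toLinearMap ∘ₗ outer d) with hA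
  refine ⟨‖A‖, norm_nonneg A, fun f g => ?_⟩
  refine (HolderSpace.norm_clmComp_le _ f).trans ?_
  rw [mul_right_comm]
  gcongr
  refine ContinuousLinearMap.opNorm_le_bound _ (by positivity) fun v => ?_
  refine (HolderSpace.norm_clmComp_le (A v) g).trans ?_
  rw [mul_right_comm]
  gcongr
  exact A.le_opNorm v

theorem tmul_sub_left (f f' g : HolderSpace d (Vec d) α) :
    tmul (f - f') g = tmul f g - tmul f' g := by
  ext x y ⟨i, j⟩
  simp [sub_mul]

theorem tmul_sub_right (f g g' : HolderSpace d (Vec d) α) :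
    tmul f (g - g') = tmul f g - tmul f g' := by
  ext x y ⟨i, j⟩
  simp [mul_sub]

end Supported

/-! ### Compactness of the embeddings of rough path spaces -/

section Time

variable {T γ γ' : ℝ} {V : Type*} [NormedAddCommGroup V]

theorem norm_le_of_timeENorm_le {Z : Simplex T → V} {M : ℝ} (hM : 0 ≤ M)
    (h : timeENorm γ Z ≤ ENNReal.ofReal M) {p : Simplex T} (hp : p.1.1 < p.1.2) :
    ‖Z p‖ ≤ M * ((p.1.2 : ℝ) - p.1.1) ^ γ := by
  have hr : 0 < ((p.1.2 : ℝ) - p.1.1) ^ γ := Real.rpow_pos_of_pos (sub_pos.2 hp) _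
  have h1 := (le_timeENorm Z hp).trans h
  rw [ENNReal.div_le_iff (by simpa using hr) ENNReal.ofReal_ne_top, ← ofReal_norm,
    ← ENNReal.ofReal_mul hM, ENNReal.ofReal_le_ofReal_iff (by positivity)] at h1
  exact h1

theorem timeENorm_le_of_norm_le {Z : Simplex T → V} {M : ℝ} (hM : 0 ≤ M)
    (h : ∀ p : Simplex T, p.1.1 < p.1.2 → ‖Z p‖ ≤ M * ((p.1.2 : ℝ) - p.1.1) ^ γ) :
    timeENorm γ Z ≤ ENNReal.ofReal M := by
  refine iSup_le fun p => iSup_le fun hp => ?_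
  have hr : 0 < ((p.1.2 : ℝ) - p.1.1) ^ γ := Real.rpow_pos_of_pos (sub_pos.2 hp) _
  rw [ENNReal.div_le_iff (by simpa using hr) ENNReal.ofReal_ne_top, ← ENNReal.ofReal_mul hM,
    ← ofReal_norm]
  exact ENNReal.ofReal_le_ofReal (h p hp)

/-- Uniform convergence and boundedness in `C^γ` imply convergence in `C^{γ'}` for `γ' < γ`. -/
theorem eventually_timeENorm_sub_le {ι : Type*} {l : Filter ι} [l.NeBot] (h0 : 0 ≤ γ')
    (hγ : γ' < γ) {Z : ι → Simplex T → V} {Z₀ : Simplex T → V} {M : ℝ}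
    (hM : ∀ᶠ i in l, ∀ p : Simplex T, p.1.1 < p.1.2 → ‖Z i p‖ ≤ M * ((p.1.2 : ℝ) - p.1.1) ^ γ)
    (hZ : TendstoUniformly Z Z₀ l) {ε : ℝ} (hε : 0 < ε) :
    ∀ᶠ i in l, timeENorm γ' (Z i - Z₀) ≤ ENNReal.ofReal ε := by
  obtain ⟨η, hη, h⟩ := exists_small_of_le_rpow h0 hγ (2 * M) hε
  filter_upwards [hM, Metric.tendstoUniformly_iff.1 hZ η hη] with i h1 h2
  refine timeENorm_le_of_norm_le hε.le fun p hp => h _ _ (sub_pos.2 hp) ?_ ?_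
  · have h3 : ‖Z₀ p‖ ≤ M * ((p.1.2 : ℝ) - p.1.1) ^ γ :=
      le_of_tendsto (hZ.tendsto_at p).norm (hM.mono fun i hi => hi p hp)
    have h4 := norm_sub_le (Z i p) (Z₀ p)
    rw [Pi.sub_apply]
    linarith [h1 p hp]
  · rw [Pi.sub_apply, ← dist_eq_norm, dist_comm]
    exact (h2 p).le

instance : CompactSpace (Simplex T) :=
  isCompact_iff_compactSpace.1 (isClosed_le continuous_fst continuous_snd).isCompact

end Time

namespace RoughPath

variable {T γ α R M : ℝ} {d : ℕ} {𝓧 : RoughPath T γ α R d}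

theorem norm_X_sub_le (hM : 0 ≤ M) (h : 𝓧.enorm ≤ ENNReal.ofReal M)
    (s t : Icc (0 : ℝ) T) : ‖𝓧.X s - 𝓧.X t‖ ≤ M * dist s t ^ γ := by
  have h1 : timeENorm γ (incr 𝓧.X) ≤ ENNReal.ofReal M := le_self_add.trans h
  have key : ∀ s t : Icc (0 : ℝ) T, s < t → ‖𝓧.X s - 𝓧.X t‖ ≤ M * dist s t ^ γ := by
    intro s t hst
    have h2 := norm_le_of_timeENorm_le hM h1 (p := ⟨(s, t), hst.le⟩) hst
    have hd : dist s t = (t : ℝ) - s := by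
      rw [dist_comm, Subtype.dist_eq, Real.dist_eq,
        abs_of_pos (sub_pos.2 (Subtype.coe_lt_coe.2 hst))]
    rw [hd, norm_sub_rev]
    exact h2
  rcases lt_trichotomy s t with hst | rfl | hst
  · exact key s t hst
  · rw [sub_self, norm_zero]
    positivity
  · rw [norm_sub_rev, dist_comm]
    exact key t s hst

/-- The seminorm only sees increments; it bounds `X` itself because `X_0 = 0`. -/
theorem norm_X_le (hγ : 0 < γ) (hM : 0 ≤ M) (h : 𝓧.enorm ≤ ENNReal.ofReal M)
    (t : Icc (0 : ℝ) T) : ‖𝓧.X t‖ ≤ M * T ^ γ := by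
  have h0 : (0 : ℝ) ∈ Icc 0 T := ⟨le_rfl, t.2.1.trans t.2.2⟩
  have h1 := norm_X_sub_le hM h t ⟨0, h0⟩
  rw [𝓧.zero ⟨0, h0⟩ rfl, sub_zero, Subtype.dist_eq, Real.dist_eq, sub_zero,
    abs_of_nonneg t.2.1] at h1
  refine h1.trans ?_
  have := t.2.2
  have := t.2.1
  gcongr

theorem norm_XX_le (hγ : 0 < γ) (hM : 0 ≤ M) (h : 𝓧.enorm ≤ ENNReal.ofReal M)
    (p : Simplex T) : ‖𝓧.XX p‖ ≤ M * ((p.1.2 : ℝ) - p.1.1) ^ (2 * γ) := by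
  rcases p.2.eq_or_lt with hp | hp
  · rw [𝓧.XX_diag hp, norm_zero, hp, sub_self, Real.zero_rpow (by positivity), mul_zero]
  · exact norm_le_of_timeENorm_le hM (le_add_self.trans h) hp

/-- The second order processes of a bounded set of rough paths are equi-Hölder on `Δ_T`. -/
theorem exists_norm_XX_sub_le (T α R : ℝ) (d : ℕ) (hγ : 0 < γ) (hM : 0 ≤ M) :
    ∃ C : ℝ, ∀ 𝓧 : RoughPath T γ α R d, 𝓧.enorm ≤ ENNReal.ofReal M →
      ∀ p q : Simplex T, ‖𝓧.XX p - 𝓧.XX q‖ ≤ C * dist p q ^ γ := by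
  obtain ⟨K, hK, htm⟩ := exists_norm_tmul_le d α
  set B : ℝ := M * T ^ γ with hB
  -- Here `B` bounds `X` uniformly. The first summand comes from the increments of `A` at both
  -- endpoints, the others from the two tensor products in `e` below.
  refine ⟨2 * (B + K * B * M) + (K * M * (2 * B) + K * B * (2 * M)), fun 𝓧 h p q => ?_⟩
  have hT : 0 ≤ T := p.1.1.2.1.trans p.1.1.2.2
  have hB0 : 0 ≤ B := by positivity
  set X : Icc (0 : ℝ) T → HolderSpace d (Vec d) α := fun t => 𝓧.X t with hX
  have hXd : ∀ s t, ‖X s - X t‖ ≤ M * dist s t ^ γ := norm_X_sub_le hM h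
  have hXb : ∀ t, ‖X t‖ ≤ B := norm_X_le hγ hM h
  set o : Icc (0 : ℝ) T := ⟨0, le_rfl, hT⟩
  have ho : ∀ t, o ≤ t := fun t => t.2.1
  have hXo : X o = 0 := by simp only [hX]; rw [𝓧.zero o rfl]; rfl
  set A : Icc (0 : ℝ) T → BiHolder d α := fun t => 𝓧.XX ⟨(o, t), ho t⟩ with hAdef
  -- Chen's relation at `0 ≤ s ≤ t` expresses `𝕏` through the one-parameter functions `A` and `X`,
  -- so regularity on the simplex reduces to regularity in one time.
  have chen : ∀ p : Simplex T, (𝓧.XX p : BiHolder d α)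
      = A p.1.2 - A p.1.1 - tmul (X p.1.1) (X p.1.2 - X p.1.1) := by
    rintro ⟨⟨s, t⟩, hst⟩
    have h1 : _ = tmul (X s - X o) (X t - X s) := 𝓧.chen o s t (ho s) hst
    rw [hXo, sub_zero] at h1
    rw [← h1]
    simp only [hAdef]
    abel
  have hA1 : ∀ s t : Icc (0 : ℝ) T, s ≤ t → ‖A s - A t‖ ≤ (B + K * B * M) * dist s t ^ γ := by
    intro s t hst
    have h1 : A t - A s = (𝓧.XX ⟨(s, t), hst⟩ : BiHolder d α) + tmul (X s) (X t - X s) := by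
      rw [chen]
      abel
    have hd : dist s t = (t : ℝ) - s := by
      rw [dist_comm, Subtype.dist_eq, Real.dist_eq,
        abs_of_nonneg (sub_nonneg.2 (Subtype.coe_le_coe.2 hst))]
    -- One factor `dist s t ^ γ` of the `2γ` bound is absorbed in `T ^ γ`, hence in `B = M * T ^ γ`.
    have h2 : ‖(𝓧.XX ⟨(s, t), hst⟩ : BiHolder d α)‖ ≤ B * dist s t ^ γ := by
      refine (norm_XX_le hγ hM h ⟨(s, t), hst⟩).trans ?_
      change M * ((t : ℝ) - s) ^ (2 * γ) ≤ _
      rw [← hd, two_mul, Real.rpow_add_of_nonneg dist_nonneg hγ.le hγ.le, hB, mul_assoc]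
      have : dist s t ≤ T := by rw [hd]; linarith [t.2.2, s.2.1]
      gcongr
    have h3 : ‖tmul (X s) (X t - X s)‖ ≤ K * B * M * dist s t ^ γ := by
      refine (htm _ _).trans ?_
      rw [mul_assoc (K * B)]
      have e1 := hXb s
      have e2 := hXd s t
      rw [norm_sub_rev] at e2
      gcongr
    rw [norm_sub_rev, h1, add_mul]
    exact (norm_add_le _ _).trans (add_le_add h2 h3)
  have hA : ∀ s t : Icc (0 : ℝ) T, ‖A s - A t‖ ≤ (B + K * B * M) * dist s t ^ γ := by
    intro s t
    rcases le_total s t with hst | hst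
    · exact hA1 s t hst
    · rw [norm_sub_rev, dist_comm]
      exact hA1 t s hst
  have hd1 : dist p.1.1 q.1.1 ^ γ ≤ dist p q ^ γ :=
    Real.rpow_le_rpow dist_nonneg (le_max_left _ _) hγ.le
  have hd2 : dist p.1.2 q.1.2 ^ γ ≤ dist p q ^ γ :=
    Real.rpow_le_rpow dist_nonneg (le_max_right _ _) hγ.le
  set D := dist p q ^ γ with hD
  have hD0 : 0 ≤ D := by positivity
  have e : ((𝓧.XX p - 𝓧.XX q : suppTensor d α R) : BiHolder d α)
      = ((A p.1.2 - A q.1.2) - (A p.1.1 - A q.1.1))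
        - (tmul (X p.1.1 - X q.1.1) (X p.1.2 - X p.1.1)
          + tmul (X q.1.1) ((X p.1.2 - X q.1.2) - (X p.1.1 - X q.1.1))) := by
    rw [Submodule.coe_sub, chen, chen]
    simp only [tmul_sub_left, tmul_sub_right]
    abel
  have f1 : ‖A p.1.2 - A q.1.2‖ ≤ (B + K * B * M) * D := (hA _ _).trans (by gcongr)
  have f2 : ‖A p.1.1 - A q.1.1‖ ≤ (B + K * B * M) * D := (hA _ _).trans (by gcongr)
  have g1 : ‖X p.1.1 - X q.1.1‖ ≤ M * D := (hXd _ _).trans (by gcongr)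
  have g2 : ‖X p.1.2 - X q.1.2‖ ≤ M * D := (hXd _ _).trans (by gcongr)
  have g3 : ‖X p.1.2 - X p.1.1‖ ≤ 2 * B := by
    linarith [norm_sub_le (X p.1.2) (X p.1.1), hXb p.1.2, hXb p.1.1]
  have g4 : ‖(X p.1.2 - X q.1.2) - (X p.1.1 - X q.1.1)‖ ≤ 2 * M * D := by
    linarith [norm_sub_le (X p.1.2 - X q.1.2) (X p.1.1 - X q.1.1)]
  have f3 : ‖tmul (X p.1.1 - X q.1.1) (X p.1.2 - X p.1.1)‖ ≤ K * (M * D) * (2 * B) :=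
    (htm _ _).trans (by gcongr)
  have f4 : ‖tmul (X q.1.1) ((X p.1.2 - X q.1.2) - (X p.1.1 - X q.1.1))‖
      ≤ K * B * (2 * M * D) := by
    refine (htm _ _).trans ?_
    have := hXb q.1.1
    gcongr
  have n1 := norm_sub_le ((A p.1.2 - A q.1.2) - (A p.1.1 - A q.1.1))
    (tmul (X p.1.1 - X q.1.1) (X p.1.2 - X p.1.1)
          + tmul (X q.1.1) ((X p.1.2 - X q.1.2) - (X p.1.1 - X q.1.1)))
  have n2 := norm_sub_le (A p.1.2 - A q.1.2) (A p.1.1 - A q.1.1)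
  have n3 := norm_add_le (tmul (X p.1.1 - X q.1.1) (X p.1.2 - X p.1.1))
    (tmul (X q.1.1) ((X p.1.2 - X q.1.2) - (X p.1.1 - X q.1.1)))
  rw [← e] at n1
  change ‖𝓧.XX p - 𝓧.XX q‖ ≤ _ at n1
  linarith

/-- A limit of rough paths, in the sense of pointwise convergence and of convergence in the Hölder
norms, is a rough path. -/
theorem exists_tendsto_of_timeENorm_sub_le {ι : Type*} {l : Filter ι} [l.NeBot]
    {𝓩 : ι → RoughPath T γ α R d} {Y : Icc (0 : ℝ) T → suppHolder d α R}
    {YY : Simplex T → suppTensor d α R}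
    (hY : ∀ t, Tendsto (fun i => (𝓩 i).X t) l (𝓝 (Y t)))
    (hYY : ∀ p, Tendsto (fun i => (𝓩 i).XX p) l (𝓝 (YY p)))
    (h₁ : ∀ ε : ℝ, 0 < ε → ∀ᶠ i in l, timeENorm γ (incr (𝓩 i).X - incr Y) ≤ ENNReal.ofReal ε)
    (h₂ : ∀ ε : ℝ, 0 < ε → ∀ᶠ i in l, timeENorm (2 * γ) ((𝓩 i).XX - YY) ≤ ENNReal.ofReal ε) :
    ∃ 𝓨 : RoughPath T γ α R d, Tendsto 𝓩 l (𝓝 𝓨) := by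
  have hchen : ∀ (s u t : Icc (0 : ℝ) T) (hsu : s ≤ u) (hut : u ≤ t),
      (YY ⟨(s, t), hsu.trans hut⟩ - YY ⟨(s, u), hsu⟩ - YY ⟨(u, t), hut⟩ : BiHolder d α)
        = tmul ((Y u - Y s : suppHolder d α R) : HolderSpace d (Vec d) α)
          ((Y t - Y u : suppHolder d α R) : HolderSpace d (Vec d) α) := by
    intro s u t hsu hut
    -- On scalar components at fixed points, Chen's relation involves only differences and products
    -- of real numbers, which pass to the limit.
    ext x y ⟨i, j⟩
    have hij : ∀ p, Tendsto (fun n => ((𝓩 n).XX p : BiHolder d α) x y (i, j)) l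
          (𝓝 ((YY p : BiHolder d α) x y (i, j))) := fun p =>
      ((EuclideanSpace.proj (𝕜 := ℝ) (i, j)).continuous.tendsto _).comp
        (HolderSpace.tendsto_apply (HolderSpace.tendsto_apply
          ((continuous_subtype_val.tendsto _).comp (hYY p)) x) y)
    have hi : ∀ t x (i : Fin d), Tendsto (fun n => ((𝓩 n).X t : HolderSpace d (Vec d) α) x i) l
          (𝓝 ((Y t : HolderSpace d (Vec d) α) x i)) := fun t x i =>
      ((EuclideanSpace.proj (𝕜 := ℝ) i).continuous.tendsto _).comp
        (HolderSpace.tendsto_apply ((continuous_subtype_val.tendsto _).comp (hY t)) x)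
    refine tendsto_nhds_unique (((hij _).sub (hij _)).sub (hij _))
      ((((hi u x i).sub (hi s x i)).mul ((hi t y j).sub (hi u y j))).congr fun n => ?_)
    exact (congrArg (fun w : BiHolder d α => w x y (i, j)) ((𝓩 n).chen s u t hsu hut)).symm
  let 𝓨 : RoughPath T γ α R d :=
    { X := Y
      XX := YY
      zero := fun t ht => tendsto_nhds_unique (hY t)
        (tendsto_const_nhds.congr fun n => ((𝓩 n).zero t ht).symm)
      holder_fst := by
        obtain ⟨n, h⟩ := (h₁ 1 one_pos).exists
        rw [← sub_sub_self (incr (𝓩 n).X) (incr Y)]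
        exact (timeENorm_sub_le _ _).trans_lt (ENNReal.add_lt_top.2
          ⟨(𝓩 n).holder_fst, h.trans_lt ENNReal.ofReal_lt_top⟩)
      holder_snd := by
        obtain ⟨n, h⟩ := (h₂ 1 one_pos).exists
        rw [← sub_sub_self (𝓩 n).XX YY]
        exact (timeENorm_sub_le _ _).trans_lt (ENNReal.add_lt_top.2
          ⟨(𝓩 n).holder_snd, h.trans_lt ENNReal.ofReal_lt_top⟩)
      chen := hchen }
  refine ⟨𝓨, EMetric.tendsto_nhds.2 fun ε hε => ?_⟩
  obtain ⟨δ, hδ, hδε⟩ : ∃ δ : ℝ, 0 < δ ∧ ENNReal.ofReal δ + ENNReal.ofReal δ < ε := by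
    obtain ⟨r, hr, hrε⟩ := ENNReal.lt_iff_exists_real_btwn.1 hε
    have hr0 : 0 < r := ENNReal.ofReal_pos.1 hrε.1
    refine ⟨r / 2, half_pos hr0, ?_⟩
    rw [← ENNReal.ofReal_add (by positivity) (by positivity), add_halves]
    exact hrε.2
  filter_upwards [h₁ δ hδ, h₂ δ hδ] with n e1 e2
  exact (add_le_add e1 e2).trans_lt hδε

variable {γ' α' : ℝ}

/-- A bounded set of rough paths in `𝒞^γ([0,T], C_R^α)` is relatively compact in
`𝒞^{γ'}([0,T], C_R^{α'})` for `γ' < γ` and `α' < α`. -/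
theorem exists_tendsto_incl (hγ0 : 0 < γ') (hγ : γ' < γ) (hα0 : 0 < α') (hα : α' < α) (hM : 0 ≤ M)
    (U : Ultrafilter (RoughPath T γ α R d))
    (hU : ∀ᶠ 𝓧 in (U : Filter (RoughPath T γ α R d)), 𝓧.enorm ≤ ENNReal.ofReal M) :
    ∃ 𝓨 : RoughPath T γ' α' R d, Tendsto (incl hγ.le hα0 hα.le) U (𝓝 𝓨) := by
  have hγp : 0 < γ := hγ0.trans hγ
  set J : RoughPath T γ α R d → RoughPath T γ' α' R d := incl hγ.le hα0 hα.le with hJ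
  set S : suppHolder d α R →L[ℝ] suppHolder d α' R := suppIncl hα0 hα.le with hSdef
  set S₂ : suppTensor d α R →L[ℝ] suppTensor d α' R := tensorIncl hα0 hα.le with hS₂def
  have hJX : ∀ 𝓧 t, (J 𝓧).X t = S (𝓧.X t) := fun _ _ => rfl
  have hJXX : ∀ 𝓧 p, (J 𝓧).XX p = S₂ (𝓧.XX p) := fun _ _ => rfl
  clear_value J S S₂
  have h1 : ∀ t, ∃ y : suppHolder d α' R, Tendsto (fun 𝓧 => (J 𝓧).X t) U (𝓝 y) := fun t => by
    obtain ⟨y, hy⟩ := exists_tendsto_suppIncl hα0 hα (M := M * T ^ γ) (U.map fun 𝓧 => 𝓧.X t) (by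
      rw [Ultrafilter.coe_map, eventually_map]
      exact hU.mono fun 𝓧 h => norm_X_le hγp hM h t)
    rw [Ultrafilter.coe_map, tendsto_map'_iff, ← hSdef] at hy
    exact ⟨y, hy.congr fun 𝓧 => (hJX 𝓧 t).symm⟩
  have h2 : ∀ p, ∃ y : suppTensor d α' R, Tendsto (fun 𝓧 => (J 𝓧).XX p) U (𝓝 y) := fun p => by
    obtain ⟨y, hy⟩ := exists_tendsto_tensorIncl hα0 hα
      (M := M * ((p.1.2 : ℝ) - p.1.1) ^ (2 * γ)) (U.map fun 𝓧 => 𝓧.XX p) (by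
        rw [Ultrafilter.coe_map, eventually_map]
        exact hU.mono fun 𝓧 h => norm_XX_le hγp hM h p)
    rw [Ultrafilter.coe_map, tendsto_map'_iff, ← hS₂def] at hy
    exact ⟨y, hy.congr fun 𝓧 => (hJXX 𝓧 p).symm⟩
  choose Y hY using h1
  choose YY hYY using h2
  have hXb : ∀ᶠ 𝓧 in (U : Filter (RoughPath T γ α R d)), ∀ s t,
      dist ((J 𝓧).X s) ((J 𝓧).X t) ≤ ‖S‖ * M * dist s t ^ γ := by
    filter_upwards [hU] with 𝓧 h s t
    rw [dist_eq_norm, hJX, hJX, ← map_sub, mul_assoc]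
    exact (S.le_opNorm _).trans
      (mul_le_mul_of_nonneg_left (norm_X_sub_le hM h s t) (norm_nonneg S))
  have huX : TendstoUniformly (fun 𝓧 => (J 𝓧).X) Y U :=
    tendstoUniformlyOn_univ.1 (tendstoUniformlyOn_of_dist_le isCompact_univ hγp
      (hXb.mono fun 𝓧 h s _ t _ => h s t) fun t _ => hY t)
  have huI : TendstoUniformly (fun 𝓧 => incr (J 𝓧).X) (incr Y) U :=
    (huX.comp fun p : Simplex T => p.1.2).sub (huX.comp fun p : Simplex T => p.1.1)
  obtain ⟨C, hC⟩ := exists_norm_XX_sub_le T α R d hγp hM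
  have huXX : TendstoUniformly (fun 𝓧 => (J 𝓧).XX) YY U := by
    refine tendstoUniformlyOn_univ.1 (tendstoUniformlyOn_of_dist_le (C := ‖S₂‖ * C) isCompact_univ
      hγp ?_ fun p _ => hYY p)
    filter_upwards [hU] with 𝓧 h p _ q _
    rw [dist_eq_norm, hJXX, hJXX, ← map_sub, mul_assoc]
    exact (S₂.le_opNorm _).trans (mul_le_mul_of_nonneg_left (hC 𝓧 h p q) (norm_nonneg S₂))
  -- Uniform convergence is upgraded to Hölder convergence in time by interpolation, between `γ'`
  -- and `γ` for the increments and between `2γ'` and `2γ` for `𝕏`.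
  refine exists_tendsto_of_timeENorm_sub_le hY hYY (fun ε hε => ?_) fun ε hε => ?_
  · refine eventually_timeENorm_sub_le hγ0.le hγ (M := ‖S‖ * M) ?_ huI hε
    filter_upwards [hXb] with 𝓧 h p hp
    have h3 := h p.1.2 p.1.1
    have hd : dist p.1.2 p.1.1 = (p.1.2 : ℝ) - p.1.1 := by
      rw [Subtype.dist_eq, Real.dist_eq, abs_of_pos (sub_pos.2 (Subtype.coe_lt_coe.2 hp))]
    rw [hd, dist_eq_norm] at h3
    exact h3
  · refine eventually_timeENorm_sub_le (by positivity) (by linarith : 2 * γ' < 2 * γ)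
      (M := ‖S₂‖ * M) ?_ huXX hε
    filter_upwards [hU] with 𝓧 h p hp
    rw [hJXX, mul_assoc]
    exact (S₂.le_opNorm _).trans
      (mul_le_mul_of_nonneg_left (norm_XX_le hγp hM h p) (norm_nonneg S₂))

end RoughPath

/-! ### Continuity of evaluations and inclusions -/

namespace RoughPath

variable {T γ α R γ' α' : ℝ} {d : ℕ}

theorem ext_apply {𝓧 𝓨 : RoughPath T γ α R d}
    (h₁ : ∀ t x, (𝓧.X t : HolderSpace d (Vec d) α) x = (𝓨.X t : HolderSpace d (Vec d) α) x)
    (h₂ : ∀ p x y, (𝓧.XX p : BiHolder d α) x y = (𝓨.XX p : BiHolder d α) x y) : 𝓧 = 𝓨 := by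
  have e₁ : 𝓧.X = 𝓨.X := funext fun t => Subtype.ext (HolderSpace.ext fun x => h₁ t x)
  have e₂ : 𝓧.XX = 𝓨.XX := funext fun p => Subtype.ext (HolderSpace.ext fun x =>
    HolderSpace.ext fun y => h₂ p x y)
  cases 𝓧
  cases 𝓨
  cases e₁
  cases e₂
  rfl

/-- Since `X_0 = 0`, the value `X_t` is the increment over `[0, t]`. This makes the pointwise
evaluations continuous. -/
theorem lipschitzWith_X (t : Icc (0 : ℝ) T) :
    LipschitzWith (Real.toNNReal ((t : ℝ) ^ γ)) fun 𝓧 : RoughPath T γ α R d => 𝓧.X t := by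
  intro 𝓧 𝓨
  change edist (𝓧.X t) (𝓨.X t) ≤ _
  have h0 : (0 : ℝ) ∈ Icc 0 T := ⟨le_rfl, t.2.1.trans t.2.2⟩
  rcases t.2.1.eq_or_lt with ht | ht
  · rw [𝓧.zero t ht.symm, 𝓨.zero t ht.symm, edist_self]
    exact zero_le
  · have hp : (0 : ℝ) < (t : ℝ) ^ γ := Real.rpow_pos_of_pos ht _
    have h := (le_timeENorm (γ := γ) (incr 𝓧.X - incr 𝓨.X) (p := ⟨(⟨0, h0⟩, t), t.2.1⟩) ht).trans
      (le_self_add.trans_eq (edist_def 𝓧 𝓨).symm)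
    simp only [Pi.sub_apply, incr, 𝓧.zero ⟨0, h0⟩ rfl, 𝓨.zero ⟨0, h0⟩ rfl, sub_zero] at h
    rw [ENNReal.div_le_iff (by simpa using hp) ENNReal.ofReal_ne_top, mul_comm] at h
    rw [edist_eq_enorm_sub]
    exact h

theorem lipschitzWith_XX (p : Simplex T) :
    LipschitzWith (Real.toNNReal (((p.1.2 : ℝ) - p.1.1) ^ (2 * γ)))
      fun 𝓧 : RoughPath T γ α R d => 𝓧.XX p := by
  intro 𝓧 𝓨
  change edist (𝓧.XX p) (𝓨.XX p) ≤ _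
  rcases p.2.eq_or_lt with hp | hp
  · rw [𝓧.XX_diag hp, 𝓨.XX_diag hp, edist_self]
    exact zero_le
  · have hr : 0 < ((p.1.2 : ℝ) - p.1.1) ^ (2 * γ) := Real.rpow_pos_of_pos (sub_pos.2 hp) _
    have h := (le_timeENorm (γ := 2 * γ) (𝓧.XX - 𝓨.XX) hp).trans
      (le_add_self.trans_eq (edist_def 𝓧 𝓨).symm)
    rw [ENNReal.div_le_iff (by simpa using hr) ENNReal.ofReal_ne_top, mul_comm] at h
    rw [edist_eq_enorm_sub]
    exact h

theorem continuous_X_apply (t : Icc (0 : ℝ) T) (x : Vec d) :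
    Continuous fun 𝓧 : RoughPath T γ α R d => (𝓧.X t : HolderSpace d (Vec d) α) x :=
  (HolderSpace.evalCLM (α := α) x).continuous.comp
    (continuous_subtype_val.comp (lipschitzWith_X t).continuous)

theorem continuous_XX_apply (p : Simplex T) (x y : Vec d) :
    Continuous fun 𝓧 : RoughPath T γ α R d => (𝓧.XX p : BiHolder d α) x y :=
  (HolderSpace.evalCLM (α := α) y).continuous.comp ((HolderSpace.evalCLM (α := α) x).continuous.comp
    (continuous_subtype_val.comp (lipschitzWith_XX p).continuous))

/-- The rough path which vanishes identically. -/
instance : Zero (RoughPath T γ α R d) where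
  zero :=
    { X := 0
      XX := 0
      zero := fun _ _ => rfl
      holder_fst := by
        have h : incr (0 : Icc (0 : ℝ) T → suppHolder d α R) = 0 := by
          ext1 p
          simp [incr]
        rw [h, timeENorm_zero]
        exact ENNReal.zero_lt_top
      holder_snd := by
        rw [timeENorm_zero]
        exact ENNReal.zero_lt_top
      chen := fun s u t hsu hut => by
        ext x y ⟨i, j⟩
        rw [tmul_apply]
        simp }

/-- Continuity of the norm follows, and with it the closedness of its sublevel sets and its
measurability. -/
theorem enorm_eq_edist (𝓧 : RoughPath T γ α R d) : 𝓧.enorm = edist 𝓧 0 := by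
  have h₁ : incr (0 : RoughPath T γ α R d).X = 0 := by
    ext1 p
    exact sub_self (0 : suppHolder d α R)
  have h₂ : (0 : RoughPath T γ α R d).XX = 0 := rfl
  rw [edist_def, h₁, h₂, sub_zero, sub_zero]
  rfl

theorem continuous_enorm : Continuous (enorm : RoughPath T γ α R d → ℝ≥0∞) := by
  simp only [funext enorm_eq_edist]
  exact continuous_id.edist continuous_const

theorem enorm_lt_top (𝓧 : RoughPath T γ α R d) : 𝓧.enorm < ∞ :=
  ENNReal.add_lt_top.2 ⟨𝓧.holder_fst, 𝓧.holder_snd⟩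

theorem incl_zero (hγ : γ' ≤ γ) (h0 : 0 < α') (hα : α' ≤ α) :
    incl hγ h0 hα (0 : RoughPath T γ α R d) = 0 :=
  ext_apply (fun _ _ => rfl) fun _ _ _ => rfl

theorem exists_lipschitzWith_incl (hγ : γ' ≤ γ) (h0 : 0 < α') (hα : α' ≤ α) :
    ∃ C, LipschitzWith C (incl hγ h0 hα : RoughPath T γ α R d → RoughPath T γ' α' R d) := by
  set S : suppHolder d α R →L[ℝ] suppHolder d α' R := suppIncl h0 hα with hS
  set S₂ : suppTensor d α R →L[ℝ] suppTensor d α' R := tensorIncl h0 hα with hS₂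
  set C₁ : ℝ≥0∞ := ‖S‖ₑ * ENNReal.ofReal (T ^ (γ - γ')) with hC₁
  set C₂ : ℝ≥0∞ := ‖S₂‖ₑ * ENNReal.ofReal (T ^ (2 * γ - 2 * γ')) with hC₂
  have hfin : C₁ + C₂ ≠ ∞ := (ENNReal.add_lt_top.2
    ⟨ENNReal.mul_lt_top _root_.enorm_lt_top ENNReal.ofReal_lt_top,
      ENNReal.mul_lt_top _root_.enorm_lt_top ENNReal.ofReal_lt_top⟩).ne
  refine ⟨(C₁ + C₂).toNNReal, fun 𝓧 𝓨 => ?_⟩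
  rw [ENNReal.coe_toNNReal hfin, edist_def, edist_def, mul_add]
  have h₁ : timeENorm γ' (incr (incl hγ h0 hα 𝓧).X - incr (incl hγ h0 hα 𝓨).X)
      ≤ C₁ * timeENorm γ (incr 𝓧.X - incr 𝓨.X) := by
    refine timeENorm_le_mul hγ fun p => ?_
    have e : (incr (incl hγ h0 hα 𝓧).X - incr (incl hγ h0 hα 𝓨).X) p
        = S ((incr 𝓧.X - incr 𝓨.X) p) := by
      simp only [Pi.sub_apply, incr, map_sub]
      rfl
    rw [e]
    exact S.le_opENorm _
  have h₂ : timeENorm (2 * γ') ((incl hγ h0 hα 𝓧).XX - (incl hγ h0 hα 𝓨).XX)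
      ≤ C₂ * timeENorm (2 * γ) (𝓧.XX - 𝓨.XX) := by
    refine timeENorm_le_mul (mul_le_mul_of_nonneg_left hγ zero_le_two) fun p => ?_
    have e : ((incl hγ h0 hα 𝓧).XX - (incl hγ h0 hα 𝓨).XX) p = S₂ ((𝓧.XX - 𝓨.XX) p) := by
      simp only [Pi.sub_apply, map_sub]
      rfl
    rw [e]
    exact S₂.le_opENorm _
  exact add_le_add (h₁.trans (by gcongr; exact le_self_add))
    (h₂.trans (by gcongr; exact le_add_self))

end RoughPath

/-! ### The projective limit -/

namespace RoughPathMinus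

variable {T γ α R : ℝ} {d : ℕ}

theorem ext_apply {𝓧 𝓨 : RoughPathMinus T γ α R d} (h₁ : ∀ t x, 𝓧.X t x = 𝓨.X t x)
    (h₂ : ∀ p x y, 𝓧.XX p x y = 𝓨.XX p x y) : 𝓧 = 𝓨 := by
  have e₁ : 𝓧.X = 𝓨.X := funext fun t => funext fun x => h₁ t x
  have e₂ : 𝓧.XX = 𝓨.XX := funext fun p => funext fun x => funext fun y => h₂ p x y
  cases 𝓧
  cases 𝓨
  cases e₁
  cases e₂
  rfl

section Topology

variable {γ' α' : ℝ} (hγ0 : 0 < γ') (hγ : γ' < γ) (hα0 : 0 < α') (hα : α' < α)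

/-- `toRoughPath` is defined by choice, but a rough path is determined by its pointwise values, so
the choice is unique. -/
theorem toRoughPath_eq {𝓧 : RoughPathMinus T γ α R d} {𝓨 : RoughPath T γ' α' R d}
    (h₁ : ∀ t x, (𝓨.X t : HolderSpace d (Vec d) α') x = 𝓧.X t x)
    (h₂ : ∀ p x y, (𝓨.XX p : BiHolder d α') x y = 𝓧.XX p x y) :
    𝓧.toRoughPath hγ0 hγ hα0 hα = 𝓨 :=
  RoughPath.ext_apply (fun t x => by rw [toRoughPath_X, h₁]) fun p x y => by rw [toRoughPath_XX, h₂]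

theorem toRoughPath_ofRoughPath (𝓧 : RoughPath T γ α R d) :
    (ofRoughPath 𝓧).toRoughPath hγ0 hγ hα0 hα = 𝓧.incl hγ.le hα0 hα.le :=
  toRoughPath_eq _ _ _ _ (fun _ _ => rfl) fun _ _ _ => rfl

theorem continuous_toRoughPath :
    Continuous (toRoughPath hγ0 hγ hα0 hα : RoughPathMinus T γ α R d → RoughPath T γ' α' R d) :=
  continuous_iff_le_induced.2 (iInf_le_of_le γ' (iInf_le_of_le α' (iInf_le_of_le hγ0
    (iInf_le_of_le hγ (iInf_le_of_le hα0 (iInf_le_of_le hα le_rfl))))))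

theorem tendsto_nhds_iff {ι : Type*} {l : Filter ι} {f : ι → RoughPathMinus T γ α R d}
    {𝓨 : RoughPathMinus T γ α R d} :
    Tendsto f l (𝓝 𝓨) ↔ ∀ (γ' α' : ℝ) (hγ0 : 0 < γ') (hγ : γ' < γ) (hα0 : 0 < α') (hα : α' < α),
      Tendsto (fun i => (f i).toRoughPath hγ0 hγ hα0 hα) l (𝓝 (𝓨.toRoughPath hγ0 hγ hα0 hα)) := by
  simp only [nhds_iInf, nhds_induced, tendsto_iInf, tendsto_comap_iff]
  rfl

end Topology

theorem continuous_ofRoughPath :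
    Continuous (ofRoughPath : RoughPath T γ α R d → RoughPathMinus T γ α R d) := by
  refine continuous_iff_continuousAt.2 fun 𝓧 => tendsto_nhds_iff.2 fun γ' α' hγ0 hγ hα0 hα => ?_
  simp only [toRoughPath_ofRoughPath]
  obtain ⟨C, hC⟩ := RoughPath.exists_lipschitzWith_incl (T := T) (R := R) (d := d) hγ.le hα0 hα.le
  exact hC.continuous.tendsto 𝓧

theorem continuous_X_apply (hγ : 0 < γ) (hα : 0 < α) (t : Icc (0 : ℝ) T) (x : Vec d) :
    Continuous fun 𝓧 : RoughPathMinus T γ α R d => 𝓧.X t x := by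
  have h := (RoughPath.continuous_X_apply (R := R) t x).comp (continuous_toRoughPath (T := T) (R := R)
    (d := d) (half_pos hγ) (half_lt_self hγ) (half_pos hα) (half_lt_self hα))
  exact h.congr fun 𝓧 => toRoughPath_X _ _ _ _ 𝓧 t x

theorem continuous_XX_apply (hγ : 0 < γ) (hα : 0 < α) (p : Simplex T) (x y : Vec d) :
    Continuous fun 𝓧 : RoughPathMinus T γ α R d => 𝓧.XX p x y := by
  have h := (RoughPath.continuous_XX_apply (R := R) p x y).comp (continuous_toRoughPath (T := T)
    (R := R) (d := d) (half_pos hγ) (half_lt_self hγ) (half_pos hα) (half_lt_self hα))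
  exact h.congr fun 𝓧 => toRoughPath_XX _ _ _ _ 𝓧 p x y

theorem continuous_eval (hγ : 0 < γ) (hα : 0 < α) (t : Icc (0 : ℝ) T) (x₁ x₂ : Vec d) :
    Continuous (eval t x₁ x₂ : RoughPathMinus T γ α R d → Vec d × Mat d) :=
  (continuous_X_apply hγ hα t x₁).prodMk (continuous_XX_apply hγ hα _ x₁ x₂)

/-- The rough paths whose norms in `𝒞^{γ'}([0,T], C_R^{α'})` are at most `C γ' α'`. -/
def boundedSet (T γ α R : ℝ) (d : ℕ) (C : ℝ → ℝ → ℝ) : Set (RoughPathMinus T γ α R d) :=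
  {𝓨 | ∀ (γ' α' : ℝ) (hγ0 : 0 < γ') (hγ : γ' < γ) (hα0 : 0 < α') (hα : α' < α),
    (𝓨.toRoughPath hγ0 hγ hα0 hα).enorm ≤ ENNReal.ofReal (C γ' α')}

theorem isClosed_boundedSet (C : ℝ → ℝ → ℝ) : IsClosed (boundedSet T γ α R d C) := by
  simp only [boundedSet, ofPred_forall]
  exact isClosed_iInter fun γ' => isClosed_iInter fun α' => isClosed_iInter fun hγ0 =>
    isClosed_iInter fun hγ => isClosed_iInter fun hα0 => isClosed_iInter fun hα =>
      isClosed_le (RoughPath.continuous_enorm.comp (continuous_toRoughPath hγ0 hγ hα0 hα))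
        continuous_const

theorem boundedSet_mono {C C' : ℝ → ℝ → ℝ} (h : ∀ γ' α', C γ' α' ≤ C' γ' α') :
    boundedSet T γ α R d C ⊆ boundedSet T γ α R d C' := fun _ h𝓨 γ' α' hγ0 hγ hα0 hα =>
  (h𝓨 γ' α' hγ0 hγ hα0 hα).trans (ENNReal.ofReal_le_ofReal (h γ' α'))

/-- For each pair `(γ', α')` there is room for a pair strictly between it and `(γ, α)`. The bound at
the intermediate exponents and the compact embedding give convergence at `(γ', α')`. -/
theorem isCompact_boundedSet (hγ : 0 < γ) (hα : 0 < α) {C : ℝ → ℝ → ℝ}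
    (hC : ∀ γ' α', 0 ≤ C γ' α') : IsCompact (boundedSet T γ α R d C) := by
  refine isCompact_iff_ultrafilter_le_nhds.2 fun U hU => ?_
  rw [le_principal_iff] at hU
  have hlim : ∀ (γ' α' : ℝ) (hγ0 : 0 < γ') (hγ : γ' < γ) (hα0 : 0 < α') (hα : α' < α),
      ∃ 𝓨 : RoughPath T γ' α' R d, Tendsto (toRoughPath hγ0 hγ hα0 hα) U (𝓝 𝓨) := by
    intro γ' α' hγ0 hγ hα0 hα
    obtain ⟨γ'', h1, h2⟩ := exists_between hγ
    obtain ⟨α'', h3, h4⟩ := exists_between hα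
    obtain ⟨𝓨, h𝓨⟩ := RoughPath.exists_tendsto_incl (T := T) (R := R) (d := d) hγ0 h1 hα0 h3
      (hC γ'' α'') (U.map (toRoughPath (hγ0.trans h1) h2 (hα0.trans h3) h4)) (by
        rw [Ultrafilter.coe_map, eventually_map]
        exact mem_of_superset hU fun 𝓧 h => h γ'' α'' (hγ0.trans h1) h2 (hα0.trans h3) h4)
    rw [Ultrafilter.coe_map, tendsto_map'_iff] at h𝓨
    refine ⟨𝓨, h𝓨.congr fun 𝓧 => (toRoughPath_eq _ _ _ _ (fun t x => ?_) fun p x y => ?_).symm⟩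
    · exact toRoughPath_X (hγ0.trans h1) h2 (hα0.trans h3) h4 𝓧 t x
    · exact toRoughPath_XX (hγ0.trans h1) h2 (hα0.trans h3) h4 𝓧 p x y
  choose Y hY using hlim
  have hX : ∀ γ' α' hγ0 hγ hα0 hα t x, Tendsto (fun 𝓧 : RoughPathMinus T γ α R d => 𝓧.X t x) U
      (𝓝 (((Y γ' α' hγ0 hγ hα0 hα).X t : HolderSpace d (Vec d) α') x)) :=
    fun γ' α' hγ0 hγ hα0 hα t x => (((RoughPath.continuous_X_apply t x).tendsto _).comp
      (hY γ' α' hγ0 hγ hα0 hα)).congr fun 𝓧 => toRoughPath_X hγ0 hγ hα0 hα 𝓧 t x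
  have hXX : ∀ γ' α' hγ0 hγ hα0 hα p x y, Tendsto
      (fun 𝓧 : RoughPathMinus T γ α R d => 𝓧.XX p x y) U
      (𝓝 (((Y γ' α' hγ0 hγ hα0 hα).XX p : BiHolder d α') x y)) :=
    fun γ' α' hγ0 hγ hα0 hα p x y => (((RoughPath.continuous_XX_apply p x y).tendsto _).comp
      (hY γ' α' hγ0 hγ hα0 hα)).congr fun 𝓧 => toRoughPath_XX hγ0 hγ hα0 hα 𝓧 p x y
  -- Any admissible pair could serve as reference: all the limits have the same pointwise values, so
  -- they glue to one element of the intersection.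
  set Y₀ := Y (γ / 2) (α / 2) (half_pos hγ) (half_lt_self hγ) (half_pos hα) (half_lt_self hα)
  have eX : ∀ γ' α' hγ0 hγ hα0 hα t x, ((Y γ' α' hγ0 hγ hα0 hα).X t : HolderSpace d (Vec d) α') x
      = (Y₀.X t : HolderSpace d (Vec d) (α / 2)) x := fun γ' α' hγ0 hγ hα0 hα t x =>
    tendsto_nhds_unique (hX γ' α' hγ0 hγ hα0 hα t x) (hX _ _ _ _ _ _ t x)
  have eXX : ∀ γ' α' hγ0 hγ hα0 hα p x y, ((Y γ' α' hγ0 hγ hα0 hα).XX p : BiHolder d α') x y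
      = (Y₀.XX p : BiHolder d (α / 2)) x y := fun γ' α' hγ0 hγ hα0 hα p x y =>
    tendsto_nhds_unique (hXX γ' α' hγ0 hγ hα0 hα p x y) (hXX _ _ _ _ _ _ p x y)
  let 𝓨 : RoughPathMinus T γ α R d :=
    { X := fun t x => (Y₀.X t : HolderSpace d (Vec d) (α / 2)) x
      XX := fun p x y => (Y₀.XX p : BiHolder d (α / 2)) x y
      exists_roughPath := fun γ' α' hγ0 hγ hα0 hα =>
        ⟨Y γ' α' hγ0 hγ hα0 hα, eX γ' α' hγ0 hγ hα0 hα, eXX γ' α' hγ0 hγ hα0 hα⟩ }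
  have hlim : Tendsto id (U : Filter (RoughPathMinus T γ α R d)) (𝓝 𝓨) :=
    tendsto_nhds_iff.2 fun γ' α' hγ0 hγ hα0 hα => by
      rw [toRoughPath_eq hγ0 hγ hα0 hα (𝓨 := Y γ' α' hγ0 hγ hα0 hα) (eX γ' α' hγ0 hγ hα0 hα)
        (eXX γ' α' hγ0 hγ hα0 hα)]
      exact hY γ' α' hγ0 hγ hα0 hα
  exact ⟨𝓨, (isClosed_boundedSet C).mem_of_tendsto hlim hU, hlim⟩

end RoughPathMinus

/-! ### Weak limits and continuous injections -/

section Measure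

theorem measure_compl_iUnion_eq_zero {E : Type*} [MeasurableSpace E]
    {μ : ProbabilityMeasure E} {K : ℕ → Set E}
    {u : ℕ → NNReal} (hu : Tendsto u atTop (𝓝 0)) (h : ∀ n, μ (K n)ᶜ ≤ u n) :
    (μ : Measure E) (⋃ n, K n)ᶜ = 0 := by
  refine le_antisymm (ge_of_tendsto' (ENNReal.tendsto_coe.2 hu) fun n => ?_) zero_le
  refine (measure_mono (compl_subset_compl.2 (subset_iUnion K n))).trans ?_
  rw [← ProbabilityMeasure.ennreal_coeFn_eq_coeFn_toMeasure]
  exact ENNReal.coe_le_coe.2 (h n)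

variable {E Y : Type*} [TopologicalSpace E] [MeasurableSpace E] [BorelSpace E]
  [TopologicalSpace Y] [MeasurableSpace Y] [BorelSpace Y]

/-- Measures which are concentrated on a `σ`-compact set are determined by their images under a
continuous injection. -/
theorem measure_eq_of_map_eq [T2Space Y] {g : E → Y} (hg : Continuous g)
    (hinj : Function.Injective g) {μ ν : Measure E} [IsProbabilityMeasure μ]
    [IsProbabilityMeasure ν] {K : ℕ → Set E} (hmono : Monotone K) (hK : ∀ n, IsCompact (K n))
    (hμ : μ (⋃ n, K n)ᶜ = 0) (hν : ν (⋃ n, K n)ᶜ = 0) (h : μ.map g = ν.map g) : μ = ν := by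
  -- The images of `s ∩ K n` are compact, hence measurable, and injectivity recovers the sets as
  -- preimages. So the image measure determines `ρ` on the `π`-system of closed sets.
  have key : ∀ (ρ : Measure E), ρ (⋃ n, K n)ᶜ = 0 → ∀ s, IsClosed s →
      ρ s = ⨆ n, ρ.map g (g '' (s ∩ K n)) := by
    intro ρ hρ s hs
    have h1 : ρ s = ρ (⋃ n, s ∩ K n) := by
      rw [← inter_iUnion]
      exact (measure_inter_conull hρ).symm
    rw [h1, Monotone.measure_iUnion fun m n hmn => inter_subset_inter_right s (hmono hmn)]
    congr 1 with n
    rw [Measure.map_apply hg.measurable (((hK n).inter_left hs).image hg).measurableSet,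
      preimage_image_eq _ hinj]
  refine ext_of_generate_finite _ (BorelSpace.measurable_eq.trans borel_eq_generateFrom_isClosed)
    isPiSystem_isClosed (fun s hs => ?_) (by simp)
  rw [key μ hμ s hs, key ν hν s hs, h]

/-- A sequential version of Prokhorov's theorem on spaces which admit a continuous injection in a
separable metrizable space. -/
theorem isSeqCompact_setOf_measure_compl_le [TopologicalSpace.PseudoMetrizableSpace Y]
    [T2Space Y] [TopologicalSpace.SeparableSpace Y] {g : E → Y} (hg : Continuous g)
    (hinj : Function.Injective g) {K : ℕ → Set E} (hmono : Monotone K) (hK : ∀ n, IsCompact (K n))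
    {u : ℕ → NNReal} (hu : Tendsto u atTop (𝓝 0)) :
    IsSeqCompact {μ : ProbabilityMeasure E | ∀ n, μ (K n)ᶜ ≤ u n} := by
  have : T2Space E := T2Space.of_injective_continuous hinj hg
  set A : Set (ProbabilityMeasure E) := {μ | ∀ n, μ (K n)ᶜ ≤ u n} with hA
  have hAc : IsCompact A :=
    isCompact_setOfPred_probabilityMeasure_mass_eq_compl_isCompact_le hu hK (Or.inr hmono)
  have : CompactSpace A := isCompact_iff_compactSpace.1 hAc
  -- A continuous injection of the compact set `A` into the Hausdorff space of laws on `Y` is a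
  -- closed embedding. Thus `A` inherits first countability, which turns compactness into sequential
  -- compactness.
  set G : A → ProbabilityMeasure Y := fun μ => (μ : ProbabilityMeasure E).map hg.aemeasurable
  have hG : Continuous G := (ProbabilityMeasure.continuous_map hg).comp continuous_subtype_val
  have hGi : Function.Injective G := by
    intro μ ν hμν
    refine Subtype.ext (Subtype.ext ?_)
    have : IsProbabilityMeasure (μ : ProbabilityMeasure E).1 := μ.1.2
    have : IsProbabilityMeasure (ν : ProbabilityMeasure E).1 := ν.1.2
    exact measure_eq_of_map_eq hg hinj hmono hK (measure_compl_iUnion_eq_zero hu μ.2)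
      (measure_compl_iUnion_eq_zero hu ν.2) (congrArg Subtype.val hμν)
  have hemb := hG.isClosedEmbedding hGi
  have : FirstCountableTopology A := hemb.isInducing.firstCountableTopology
  intro x hx
  obtain ⟨a, φ, hφ, ha⟩ := CompactSpace.tendsto_subseq fun n => (⟨x n, hx n⟩ : A)
  exact ⟨a, a.2, φ, hφ, (continuous_subtype_val.tendsto a).comp ha⟩

end Measure

/-! ### Finite-dimensional distributions -/

section Separating

variable {T : ℝ}

theorem continuous_of_norm_sub_le_rpow {X V : Type*} [PseudoMetricSpace X]
    [SeminormedAddCommGroup V] {f : X → V} {C β : ℝ} (hβ : 0 < β)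
    (h : ∀ x y, ‖f x - f y‖ ≤ C * dist x y ^ β) : Continuous f := by
  refine continuous_iff_continuousAt.2 fun x => tendsto_iff_norm_sub_tendsto_zero.2 ?_
  refine squeeze_zero (fun _ => norm_nonneg _) (fun y => h y x) ?_
  have hc : Continuous fun y => C * dist y x ^ β :=
    continuous_const.mul ((continuous_id.dist continuous_const).rpow_const fun _ => Or.inr hβ.le)
  have := hc.tendsto x
  rwa [dist_self, Real.zero_rpow hβ.ne', mul_zero] at this

/-- Pairs `(q, n)` such that `q + n √2 ∈ [0, T]`.  For fixed `n`, these times are dense in `[0, T]`,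
and all these times are different. -/
abbrev TimeIndex (T : ℝ) : Type := {i : ℚ × ℕ // (i.1 : ℝ) + i.2 * √2 ∈ Icc 0 T}

/-- The time `q + n √2`. -/
def TimeIndex.time (i : TimeIndex T) : Icc (0 : ℝ) T := ⟨i.1.1 + i.1.2 * √2, i.2⟩

/-- By irrationality of `√2`. Distinct times are needed because `SameFDD` tests strictly increasing
times, with a single pair of space points at each; the shifts by `n √2` let every `n` carry its own
pair on a dense set of times. -/
theorem TimeIndex.time_injective : Function.Injective (TimeIndex.time : TimeIndex T → _) := by
  rintro ⟨⟨q, n⟩, hi⟩ ⟨⟨q', n'⟩, hj⟩ h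
  have h1 : (q : ℝ) + n * √2 = q' + n' * √2 := congrArg Subtype.val h
  have h2 : n = n' := by
    by_contra hne
    have h3 : ((n : ℤ) - n' : ℤ) ≠ 0 := by omega
    refine (irrational_sqrt_two.intCast_mul h3).ne_rat (q' - q) ?_
    push_cast
    linarith
  subst h2
  have h4 : q = q' := by
    have : (q : ℝ) = q' := by linarith
    exact_mod_cast this
  subst h4
  rfl

theorem TimeIndex.dense (hT : 0 < T) (n : ℕ) :
    Dense {t : Icc (0 : ℝ) T | ∃ i : TimeIndex T, i.1.2 = n ∧ i.time = t} := by
  intro t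
  rw [Metric.mem_closure_iff]
  intro ε hε
  have hlt : max 0 (t - ε) < min T (t + ε) := by
    have h1 := t.2.1
    have h2 := t.2.2
    refine max_lt (lt_min hT ?_) (lt_min ?_ ?_) <;> linarith
  obtain ⟨q, hq1, hq2⟩ := exists_rat_btwn (sub_lt_sub_right hlt (n * √2))
  have h1 := le_max_left 0 ((t : ℝ) - ε)
  have h2 := le_max_right 0 ((t : ℝ) - ε)
  have h3 := min_le_left T ((t : ℝ) + ε)
  have h4 := min_le_right T ((t : ℝ) + ε)
  have hmem : ((q, n).1 : ℝ) + (q, n).2 * √2 ∈ Icc 0 T :=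
    ⟨by simp only; linarith, by simp only; linarith⟩
  refine ⟨_, ⟨⟨(q, n), hmem⟩, rfl, rfl⟩, ?_⟩
  rw [Subtype.dist_eq, Real.dist_eq, abs_lt]
  constructor <;> simp only [TimeIndex.time] <;> linarith

end Separating

theorem HolderSpace.continuous_apply {d : ℕ} {E : Type*} [NormedAddCommGroup E] [NormedSpace ℝ E]
    {α : ℝ} : Continuous fun p : HolderSpace d E α × Vec d => p.1 p.2 := by
  refine continuous_iff_continuousAt.2 fun ⟨f, y⟩ => tendsto_iff_norm_sub_tendsto_zero.2 ?_
  refine squeeze_zero (g := fun p : HolderSpace d E α × Vec d => ‖p.1 - f‖ + ‖f p.2 - f y‖)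
    (fun _ => norm_nonneg _) (fun p => ?_) ?_
  · rw [← sub_add_sub_cancel (p.1 p.2) (f p.2) (f y)]
    exact (norm_add_le _ _).trans (add_le_add_left ((p.1 - f).norm_apply_le p.2) _)
  · have hc : Continuous fun p : HolderSpace d E α × Vec d => ‖p.1 - f‖ + ‖f p.2 - f y‖ :=
      (continuous_fst.sub continuous_const).norm.add
        ((f.contDiff.continuous.comp continuous_snd).sub continuous_const).norm
    have := hc.tendsto (f, y)
    simpa using this

namespace RoughPathMinus

variable {T γ α R : ℝ} {d : ℕ}

/-- The time-dependence of a rough path is continuous. -/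
theorem continuous_eval_time (hγ : 0 < γ) (hα : 0 < α) (𝓧 : RoughPathMinus T γ α R d)
    (x₁ x₂ : Vec d) : Continuous fun t => eval t x₁ x₂ 𝓧 := by
  set 𝓨 := 𝓧.toRoughPath (half_pos hγ) (half_lt_self hγ) (half_pos hα) (half_lt_self hα) with h𝓨
  have hX : ∀ t x, (𝓨.X t : HolderSpace d (Vec d) (α / 2)) x = 𝓧.X t x := fun t x =>
    toRoughPath_X _ _ _ _ 𝓧 t x
  have hXX : ∀ p x y, (𝓨.XX p : BiHolder d (α / 2)) x y = 𝓧.XX p x y := fun p x y =>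
    toRoughPath_XX _ _ _ _ 𝓧 p x y
  have hM : 𝓨.enorm ≤ ENNReal.ofReal 𝓨.enorm.toReal :=
    (ENNReal.ofReal_toReal 𝓨.enorm_lt_top.ne).ge
  have c₁ : Continuous 𝓨.X := continuous_of_norm_sub_le_rpow (half_pos hγ)
    (RoughPath.norm_X_sub_le ENNReal.toReal_nonneg hM)
  obtain ⟨C, hC⟩ := RoughPath.exists_norm_XX_sub_le T (α / 2) R d (half_pos hγ)
    (ENNReal.toReal_nonneg (a := 𝓨.enorm))
  have c₂ : Continuous 𝓨.XX := continuous_of_norm_sub_le_rpow (half_pos hγ) (hC 𝓨 hM)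
  refine Continuous.prodMk ?_ ?_
  · simp only [← hX]
    exact (HolderSpace.evalCLM (α := α / 2) x₁).continuous.comp (continuous_subtype_val.comp c₁)
  · simp only [← hXX]
    refine (HolderSpace.evalCLM (α := α / 2) x₂).continuous.comp
      ((HolderSpace.evalCLM (α := α / 2) x₁).continuous.comp
        (continuous_subtype_val.comp (c₂.comp ?_)))
    exact Continuous.subtype_mk (f := fun t : Icc (0 : ℝ) T =>
      ((⟨0, le_rfl, t.2.1.trans t.2.2⟩ : Icc (0 : ℝ) T), t))
      ((continuous_const.subtype_mk _).prodMk continuous_id) _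

theorem continuous_eval_space (hγ : 0 < γ) (hα : 0 < α) (𝓧 : RoughPathMinus T γ α R d)
    (t : Icc (0 : ℝ) T) : Continuous fun x : Vec d × Vec d => eval t x.1 x.2 𝓧 := by
  set 𝓨 := 𝓧.toRoughPath (half_pos hγ) (half_lt_self hγ) (half_pos hα) (half_lt_self hα) with h𝓨
  have hX : ∀ t x, (𝓨.X t : HolderSpace d (Vec d) (α / 2)) x = 𝓧.X t x := fun t x =>
    toRoughPath_X _ _ _ _ 𝓧 t x
  have hXX : ∀ p x y, (𝓨.XX p : BiHolder d (α / 2)) x y = 𝓧.XX p x y := fun p x y =>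
    toRoughPath_XX _ _ _ _ 𝓧 p x y
  refine Continuous.prodMk ?_ ?_
  · simp only [← hX]
    exact (HolderSpace.contDiff _).continuous.comp continuous_fst
  · simp only [← hXX]
    exact HolderSpace.continuous_apply.comp
      (((HolderSpace.contDiff _).continuous.comp continuous_fst).prodMk continuous_snd)

/-- By Chen's relation, a rough path is determined by its space-time evaluations. -/
theorem ext_eval (hγ : 0 < γ) (hα : 0 < α) {𝓧 𝓨 : RoughPathMinus T γ α R d}
    (h : ∀ t x₁ x₂, eval t x₁ x₂ 𝓧 = eval t x₁ x₂ 𝓨) : 𝓧 = 𝓨 := by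
  have hX : ∀ t x, 𝓧.X t x = 𝓨.X t x := fun t x => congrArg Prod.fst (h t x x)
  have chen : ∀ (𝓩 : RoughPathMinus T γ α R d) (s t : Icc (0 : ℝ) T) (hst : s ≤ t) (x y : Vec d),
      𝓩.XX ⟨(s, t), hst⟩ x y = (eval t x y 𝓩).2 - (eval s x y 𝓩).2
        - outer d (𝓩.X s x - 𝓩.X ⟨0, le_rfl, s.2.1.trans s.2.2⟩ x) (𝓩.X t y - 𝓩.X s y) := by
    intro 𝓩 s t hst x y
    have hc := (𝓩.toRoughPath (half_pos hγ) (half_lt_self hγ) (half_pos hα)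
      (half_lt_self hα)).chen ⟨0, le_rfl, s.2.1.trans s.2.2⟩ s t s.2.1 hst
    have hc' := congrArg (fun w : BiHolder d (α / 2) => w x y) hc
    simp only [HolderSpace.sub_apply, toRoughPath_XX, tmul_apply_eq, Submodule.coe_sub,
      toRoughPath_X] at hc'
    rw [← hc']
    simp only [eval]
    abel
  refine ext_apply hX ?_
  rintro ⟨⟨s, t⟩, hst⟩ x y
  rw [chen 𝓧, chen 𝓨, h, h]
  simp only [hX]

/-- Countably many space-time evaluations, at different times, which determine the rough path. -/
def evalSeq (T γ α R : ℝ) (d : ℕ) (𝓧 : RoughPathMinus T γ α R d) (i : TimeIndex T) :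
    Vec d × Mat d :=
  eval i.time (TopologicalSpace.denseSeq (Vec d × Vec d) i.1.2).1
    (TopologicalSpace.denseSeq (Vec d × Vec d) i.1.2).2 𝓧

theorem continuous_evalSeq (hγ : 0 < γ) (hα : 0 < α) : Continuous (evalSeq T γ α R d) :=
  continuous_pi fun _ => continuous_eval hγ hα _ _ _

/-- For each space pair of the dense sequence, agreement at dense times extends by continuity in
time; agreement at all times then extends by continuity in space. -/
theorem evalSeq_injective (hT : 0 < T) (hγ : 0 < γ) (hα : 0 < α) :
    Function.Injective (evalSeq T γ α R d) := by
  intro 𝓧 𝓨 h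
  have h₁ : ∀ n t, eval t (TopologicalSpace.denseSeq (Vec d × Vec d) n).1
      (TopologicalSpace.denseSeq (Vec d × Vec d) n).2 𝓧
      = eval t (TopologicalSpace.denseSeq (Vec d × Vec d) n).1
        (TopologicalSpace.denseSeq (Vec d × Vec d) n).2 𝓨 := by
    intro n
    refine congrFun ((continuous_eval_time hγ hα 𝓧 _ _).ext_on (TimeIndex.dense hT n)
      (continuous_eval_time hγ hα 𝓨 _ _) ?_)
    rintro _ ⟨i, rfl, rfl⟩
    exact congrFun h i
  refine ext_eval hγ hα fun t x₁ x₂ => ?_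
  have h₂ := (continuous_eval_space hγ hα 𝓧 t).ext_on
    (TopologicalSpace.denseRange_denseSeq (Vec d × Vec d)) (continuous_eval_space hγ hα 𝓨 t) (by
      rintro _ ⟨n, rfl⟩
      exact h₁ n t)
  exact congrFun h₂ (x₁, x₂)

/-- A law on a product is determined by its finite marginals. The finitely many indices of a
marginal have different times, so sorting by time brings it to the form tested by `SameFDD`. -/
theorem SameFDD.map_evalSeq_eq (hγ : 0 < γ) (hα : 0 < α)
    {μ ν : Measure (RoughPathMinus T γ α R d)} [IsProbabilityMeasure μ] [IsProbabilityMeasure ν]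
    (h : SameFDD μ ν) : μ.map (evalSeq T γ α R d) = ν.map (evalSeq T γ α R d) := by
  have hg : Measurable (evalSeq T γ α R d) := (continuous_evalSeq hγ hα).measurable
  have : IsProbabilityMeasure (ν.map (evalSeq T γ α R d)) :=
    Measure.isProbabilityMeasure_map hg.aemeasurable
  refine IsProjectiveLimit.unique (P := fun I => (ν.map (evalSeq T γ α R d)).map I.restrict)
    (fun I => ?_) fun I => rfl
  have hr : Measurable (I.restrict : (TimeIndex T → Vec d × Mat d) → _) := I.measurable_restrict
  change (μ.map _).map _ = (ν.map _).map _
  rw [Measure.map_map hr hg, Measure.map_map hr hg]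
  classical
  set J : Finset (Icc (0 : ℝ) T) := I.image TimeIndex.time with hJ
  set e : Fin J.card ≃o J := J.orderIsoOfFin rfl with he
  have hex : ∀ j, ∃ i ∈ I, TimeIndex.time i = e j := fun j => Finset.mem_image.1 (e j).2
  choose i hiI hi using hex
  set idx : I → Fin J.card := fun k => e.symm ⟨TimeIndex.time k.1, Finset.mem_image_of_mem _ k.2⟩
  have hidx : ∀ k, i (idx k) = k := fun k => TimeIndex.time_injective (by
    rw [hi]
    simp only [idx, OrderIso.apply_symm_apply])
  have hfac : (I.restrict ∘ evalSeq T γ α R d) =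
      (fun (w : Fin J.card → Vec d × Mat d) k => w (idx k)) ∘ fun 𝓧 j => evalSeq T γ α R d 𝓧 (i j) := by
    ext1 𝓧
    funext k
    simp only [Function.comp_apply, Finset.restrict, hidx]
  have hm₁ : Measurable (fun (w : Fin J.card → Vec d × Mat d) (k : I) => w (idx k)) :=
    measurable_pi_lambda _ fun k => measurable_pi_apply _
  have hm₂ : Measurable (fun (𝓧 : RoughPathMinus T γ α R d) j => evalSeq T γ α R d 𝓧 (i j)) :=
    measurable_pi_lambda _ fun j => (measurable_pi_apply (i j)).comp hg
  rw [hfac, ← Measure.map_map hm₁ hm₂, ← Measure.map_map hm₁ hm₂]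
  congr 1
  refine h J.card (fun j => (i j).time) _ _ fun j j' hjj' => ?_
  simp only [hi]
  exact e.strictMono hjj'

end RoughPathMinus

/-! ### Tightness -/

namespace RoughPathMinus

variable {T γ α R : ℝ} {d : ℕ}

/-- Bounded sets of rough paths are contained in bounded sets of the projective limit. -/
theorem exists_ofRoughPath_mem_boundedSet (T γ α R : ℝ) (d : ℕ) :
    ∃ C : ℝ → ℝ → ℝ, (∀ γ' α', 0 ≤ C γ' α') ∧ ∀ (N : ℝ), 0 ≤ N → ∀ 𝓧 : RoughPath T γ α R d,
      𝓧.enorm ≤ ENNReal.ofReal N →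
        ofRoughPath 𝓧 ∈ boundedSet T γ α R d fun γ' α' => C γ' α' * N := by
  have h : ∀ γ' α' : ℝ, ∃ C : ℝ, 0 ≤ C ∧ ∀ (hγ : γ' < γ) (h0 : 0 < α') (hα : α' < α)
      (𝓧 : RoughPath T γ α R d),
      (𝓧.incl hγ.le h0 hα.le).enorm ≤ ENNReal.ofReal C * 𝓧.enorm := by
    intro γ' α'
    by_cases hyp : γ' < γ ∧ 0 < α' ∧ α' < α
    · obtain ⟨C, hC⟩ := RoughPath.exists_lipschitzWith_incl (T := T) (R := R) (d := d)
        hyp.1.le hyp.2.1 hyp.2.2.le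
      refine ⟨C, C.2, fun hγ h0 hα 𝓧 => ?_⟩
      have := hC 𝓧 0
      rwa [RoughPath.incl_zero, ← RoughPath.enorm_eq_edist, ← RoughPath.enorm_eq_edist,
        ← ENNReal.ofReal_coe_nnreal] at this
    -- A dummy constant for inadmissible exponents.
    · exact ⟨0, le_rfl, fun hγ h0 hα => absurd ⟨hγ, h0, hα⟩ hyp⟩
  choose C hC0 hC using h
  refine ⟨C, hC0, fun N hN 𝓧 h𝓧 γ' α' hγ0 hγ hα0 hα => ?_⟩
  rw [toRoughPath_ofRoughPath, ENNReal.ofReal_mul (hC0 γ' α')]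
  exact (hC γ' α' hγ hα0 hα 𝓧).trans (by gcongr)

end RoughPathMinus

/-- Markov's inequality. With threshold `n + 1 ≥ 1` and `p ≥ 1` one has `f ≤ f ^ p` on the event, so
the rate `1 / (n + 1)` holds for every `p`, which is enough for tightness. -/
theorem measure_lt_le_of_lintegral_rpow {Ω : Type*} [MeasurableSpace Ω] {P : Measure Ω}
    {f : Ω → ℝ≥0∞} (hf : Measurable f) {p : ℝ} (hp : 1 ≤ p) {C : ℝ≥0∞}
    (hC : ∫⁻ ω, f ω ^ p ∂P ≤ C) (n : ℕ) :
    P {ω | ENNReal.ofReal (n + 1) < f ω} ≤ C / (n + 1) := by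
  have h1 : P {ω | ENNReal.ofReal (n + 1) < f ω} ≤ P {ω | ((n : ℝ≥0∞) + 1) ≤ f ω ^ p} := by
    refine measure_mono fun ω hω => ?_
    have e : ENNReal.ofReal ((n : ℝ) + 1) = (n : ℝ≥0∞) + 1 := by
      rw [ENNReal.ofReal_add (Nat.cast_nonneg n) zero_le_one, ENNReal.ofReal_natCast,
        ENNReal.ofReal_one]
    have h2 : (n : ℝ≥0∞) + 1 < f ω := e ▸ hω
    have h3 : 1 ≤ f ω := le_add_self.trans h2.le
    exact h2.le.trans (by simpa using ENNReal.rpow_le_rpow_of_exponent_le h3 hp)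
  refine h1.trans ((ENNReal.le_div_iff_mul_le (Or.inl (by simp)) (Or.inl (by finiteness))).2 ?_)
  rw [mul_comm]
  exact (mul_meas_ge_le_lintegral (hf.pow_const p) _).trans hC

end RoughHolder

end

/-! ### Convergence of the whole sequence -/

theorem mainTheorem3 (d : ℕ) {T γ α R p : ℝ} (hT : 0 < T) (hγ : 1 / 3 < γ) (hγ1 : γ ≤ 1)
    (hα : 0 < α) (hR : 0 < R) (hp : 1 ≤ p)
    {Ω : ℕ → Type*} [∀ n, MeasurableSpace (Ω n)] (P : ∀ n, Measure (Ω n))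
    [∀ n, IsProbabilityMeasure (P n)]
    (𝓧 : ∀ n, Ω n → RoughHolder.RoughPath T γ α R d) (h𝓧 : ∀ n, Measurable (𝓧 n))
    (hmoment : (⨆ n, ∫⁻ ω, (𝓧 n ω).enorm ^ p ∂(P n)) < ∞)
    (hlimit : ∀ (μ ν : Measure (RoughHolder.RoughPathMinus T γ α R d)) [IsProbabilityMeasure μ]
      [IsProbabilityMeasure ν],
      RoughHolder.RoughPathMinus.IsWeakLimitPoint P
        (fun n ω => RoughHolder.RoughPathMinus.ofRoughPath (𝓧 n ω)) μ →
      RoughHolder.RoughPathMinus.IsWeakLimitPoint P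
        (fun n ω => RoughHolder.RoughPathMinus.ofRoughPath (𝓧 n ω)) ν →
      RoughHolder.RoughPathMinus.SameFDD μ ν) :
    ∃ (μ : Measure (RoughHolder.RoughPathMinus T γ α R d)) (_ : IsProbabilityMeasure μ),
      TendstoInDistribution (fun n ω => RoughHolder.RoughPathMinus.ofRoughPath (𝓧 n ω)) atTop
        (fun 𝓨 : RoughHolder.RoughPathMinus T γ α R d => 𝓨) P μ := by
  have hγ0 : 0 < γ := by linarith
  obtain ⟨C, hC0, hC⟩ := RoughHolder.RoughPathMinus.exists_ofRoughPath_mem_boundedSet T γ α R d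
  set K : ℕ → Set (RoughHolder.RoughPathMinus T γ α R d) := fun n =>
    RoughHolder.RoughPathMinus.boundedSet T γ α R d fun γ' α' => C γ' α' * (n + 1) with hKdef
  have hKmono : Monotone K := fun m n hmn =>
    RoughHolder.RoughPathMinus.boundedSet_mono fun γ' α' => by
      have := hC0 γ' α'
      gcongr
  have hKc : ∀ n, IsCompact (K n) := fun n =>
    RoughHolder.RoughPathMinus.isCompact_boundedSet hγ0 hα fun γ' α' =>
      mul_nonneg (hC0 γ' α') (by positivity)
  have hmeas : ∀ n, Measurable fun ω => RoughHolder.RoughPathMinus.ofRoughPath (𝓧 n ω) := fun n =>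
    RoughHolder.RoughPathMinus.continuous_ofRoughPath.measurable.comp (h𝓧 n)
  set B : NNReal := (⨆ n, ∫⁻ ω, (𝓧 n ω).enorm ^ p ∂(P n)).toNNReal with hB
  have hBe : (B : ℝ≥0∞) = ⨆ n, ∫⁻ ω, (𝓧 n ω).enorm ^ p ∂(P n) := ENNReal.coe_toNNReal hmoment.ne
  set u : ℕ → NNReal := fun n => B / (n + 1) with hudef
  have hu : Tendsto u atTop (𝓝 0) := by
    have h := (tendsto_one_div_add_atTop_nhds_zero_nat (𝕜 := NNReal)).const_mul B
    simpa only [mul_zero, mul_one_div] using h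
  set L : ℕ → ProbabilityMeasure (RoughHolder.RoughPathMinus T γ α R d) := fun n =>
    ⟨(P n).map fun ω => RoughHolder.RoughPathMinus.ofRoughPath (𝓧 n ω),
      Measure.isProbabilityMeasure_map (hmeas n).aemeasurable⟩ with hL
  -- Tightness, uniform in `m`: outside `K n` the norm exceeds `n + 1`, which has probability at
  -- most `B / (n + 1)`.
  have hLK : ∀ m, L m ∈ {μ : ProbabilityMeasure (RoughHolder.RoughPathMinus T γ α R d) |
      ∀ n, μ (K n)ᶜ ≤ u n} := by
    intro m n
    rw [← ENNReal.coe_le_coe, ProbabilityMeasure.ennreal_coeFn_eq_coeFn_toMeasure]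
    change ((P m).map fun ω => RoughHolder.RoughPathMinus.ofRoughPath (𝓧 m ω)) (K n)ᶜ ≤ _
    rw [Measure.map_apply (hmeas m)
      (RoughHolder.RoughPathMinus.isClosed_boundedSet _).measurableSet.compl]
    have hle : ∫⁻ ω, (𝓧 m ω).enorm ^ p ∂(P m) ≤ B :=
      (le_iSup (fun n => ∫⁻ ω, (𝓧 n ω).enorm ^ p ∂(P n)) m).trans_eq hBe.symm
    have h := RoughHolder.measure_lt_le_of_lintegral_rpow (f := fun ω => (𝓧 m ω).enorm)
      (RoughHolder.RoughPath.continuous_enorm.measurable.comp (h𝓧 m)) hp hle n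
    have hun : (u n : ℝ≥0∞) = B / (n + 1) := by
      rw [hudef, ENNReal.coe_div (by positivity)]
      push_cast
      rfl
    rw [hun]
    refine (measure_mono fun ω hω => ?_).trans h
    by_contra hcon
    exact hω (hC (n + 1) (by positivity) (𝓧 m ω) (not_lt.1 hcon))
  have hseq := RoughHolder.isSeqCompact_setOf_measure_compl_le
    (RoughHolder.RoughPathMinus.continuous_evalSeq (T := T) (R := R) (d := d) hγ0 hα)
    (RoughHolder.RoughPathMinus.evalSeq_injective hT hγ0 hα) hKmono hKc hu
  have hlim : ∀ (μ : ProbabilityMeasure (RoughHolder.RoughPathMinus T γ α R d)) (φ : ℕ → ℕ),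
      StrictMono φ → Tendsto (L ∘ φ) atTop (𝓝 μ) →
      RoughHolder.RoughPathMinus.IsWeakLimitPoint P
        (fun n ω => RoughHolder.RoughPathMinus.ofRoughPath (𝓧 n ω))
        (μ : Measure (RoughHolder.RoughPathMinus T γ α R d)) := by
    intro μ φ hφ h
    refine ⟨φ, hφ, fun k => (hmeas (φ k)).aemeasurable, aemeasurable_id, ?_⟩
    convert! h using 2
    refine congrArg 𝓝 (Subtype.ext ?_)
    exact Measure.map_id
  obtain ⟨μ, hμK, φ, hφ, hμ⟩ := hseq hLK
  have hconv : Tendsto L atTop (𝓝 μ) := by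
    refine tendsto_of_subseq_tendsto fun ns hns => ?_
    -- The given `ns` need not be monotone, whereas weak limit points are defined by strictly
    -- increasing subsequences.
    obtain ⟨ψ, -, hψ⟩ := strictMono_subseq_of_tendsto_atTop hns
    obtain ⟨ν, hνK, χ, hχ, hν⟩ := hseq fun n => hLK (ns (ψ n))
    have hfdd := hlimit (μ : Measure (RoughHolder.RoughPathMinus T γ α R d)) ν (hlim μ φ hφ hμ)
      (hlim ν _ (hψ.comp hχ) hν)
    have : IsProbabilityMeasure μ.1 := μ.2
    have : IsProbabilityMeasure ν.1 := ν.2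
    -- Limits of the tight sequence obey the same tail bounds, so both laws are concentrated on `⋃
    -- n, K n` and are determined by their images under `evalSeq`.
    have hμν : μ = ν := Subtype.ext (RoughHolder.measure_eq_of_map_eq
      (RoughHolder.RoughPathMinus.continuous_evalSeq hγ0 hα)
      (RoughHolder.RoughPathMinus.evalSeq_injective hT hγ0 hα) hKmono hKc
      (RoughHolder.measure_compl_iUnion_eq_zero hu hμK)
      (RoughHolder.measure_compl_iUnion_eq_zero hu hνK) (hfdd.map_evalSeq_eq hγ0 hα))
    exact ⟨ψ ∘ χ, hμν ▸ hν⟩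
  refine ⟨μ, inferInstance, fun n => (hmeas n).aemeasurable, aemeasurable_id, ?_⟩
  convert! hconv using 2
  refine congrArg 𝓝 (Subtype.ext ?_)
  exact Measure.map_id
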